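/- \textbf{Setting.} Let $E$ be a topological space with its Borel $\sigma$-algebra, $\mu$ a $\sigma$-finite Borel measure on $E$, and $H=L^2(E,\mu)$ (real) with inner product $(\cdot,\cdot)$. For a non-negative bilinear form $a$ with domain $D(a)\subset H$ put $a_\alpha=a+\alpha(\cdot,\cdot)$ and $\|u\|_{D(a)}=a_1(u,u)^{1/2}$. It is a \emph{coercive closed form} if $D(a)$ is dense in $H$, complete for $\|\cdot\|_{D(a)}$, and $|a_1(u,v)|\le K\|u\|_{D(a)}\|v\|_{D(a)}$ for some $K>0$ (a \emph{sector constant}). Let $(\mathcal A,D(\mathcal A))$ be a semi-Dirichlet form on $H$: a coercive closed form such that for $u\in D(\mathcal A)$ one has $w:=u^+\wedge 1\in D(\mathcal A)$ and $\mathcal A(u+w,u-w)\ge 0$. Let $(\mathcal E,\mathcal F)$ be a generalized Dirichlet form on $H$, that is: $(\mathcal Q,D(\mathcal Q))$ is a coercive closed form on $H$; $(\Lambda,D(\Lambda,H))$ is the generator of a $C_0$-semigroup of contractions on $H$ which restricts to a $C_0$-semigroup on $D(\mathcal Q)$; $(\Lambda,\mathcal F)$ is the closure of $\Lambda:D(\Lambda,H)\cap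 D(\mathcal Q)\to D(\mathcal Q)'$ as an operator from $D(\mathcal Q)$ to $D(\mathcal Q)'$, with $\|f\|_{\mathcal F}^2=\|f\|_{D(\mathcal Q)}^2+\|\Lambda f\|_{D(\mathcal Q)'}^2$; $\mathcal E(u,v)=\mathcal Q(u,v)-\langle\Lambda u,v\rangle$ for $u\in\mathcal F$, $v\in D(\mathcal Q)$, and $\mathcal E_\alpha=\mathcal E+\alpha(\cdot,\cdot)$; and for $u\in\mathcal F$ one has $u^+\wedge1\in D(\mathcal Q)$ and $\mathcal E(u,u-u^+\wedge 1)\ge0$. Let $K'>0$ be a sector constant of $\mathcal Q$. The resolvent $(G_\alpha)_{\alpha>0}$ is given by $G_\alpha f\in\mathcal F$, $\mathcal E_\alpha(G_\alpha f,v)=(f,v)$ for all $v\in D(\mathcal Q)$. An element $u\in H$ is \emph{1-excessive} if $\alpha G_{\alpha+1}u\le u$ $\mu$-a.e. for all $\alpha\ge0$. For an open set $U$ and $u \in H$, the \emph{1-reduced function} $u_U$ is the least 1-excessive element of $H$ that dominates $u\cdot 1_U$ $\mu$-a.e. An increasing sequence $(F_k)$ of closed sets is an \emph{$\mathcal E$-nest}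 if $u_{E\setminus F_k}\to0$ strongly in $L^2(E,\mu)$ and weakly in $D(\mathcal Q)$ for every 1-excessive $u\in\mathcal F$; it is an \emph{$\mathcal A$-nest} if $\bigcup_k\{u\in D(\mathcal A): u=0\ \mu\text{-a.e. on }E\setminus F_k\}$ is dense in $D(\mathcal A)$. \textbf{Assumptions.} (C1) $C>0$ is a constant such that $\mathcal F\subset D(\mathcal A)$ and $\mathcal A_1(u,u)\le C\,\mathcal E_1(u,u)$ for all $u\in\mathcal F$. (C2) For some $\gamma>0$, $G_\gamma$ maps the bounded elements of $L^2(E,\mu)$ onto a subset of $D(\mathcal A)$ which is dense in $D(\mathcal A)$. \textbf{Claim.} Under (C1) and (C2): \begin{itemize} \item[(i)] Every 1-excessive $u\in L^2(E,\mu)$ with $u\le f$ for some $f\in\mathcal F$ lies in $D(\mathcal A)$. \item[(ii)] If $u\in L^2(E,\mu)$ is 1-excessive, $u\le f\in\mathcal F$, and $U\subset E$ is open, then $u_U$ exists, $u_U\in D(\mathcal A)$, and $\|u_U\|_{D(\mathcal A)}\le(\sqrt C\,(K'+1)+1)\,\|f\|_{\mathcal F}$. \item[(iii)] Every $\mathcal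 E$-nest is an $\mathcal A$-nest. \end{itemize} -/

import Mathlib

open MeasureTheory Filter Topology
open scoped ENNReal

noncomputable section

/-! ### Bilinear forms on a Hilbert space and their form domains -/

section Forms

variable {H : Type*} [NormedAddCommGroup H] [InnerProductSpace ℝ H]

/-- A bilinear form `a : D(a) × D(a) → ℝ` on a linear subspace `D(a)` of `H`
with `a(u, u) ≥ 0` for all `u`. -/
structure NonnegForm (H : Type*) [NormedAddCommGroup H] [InnerProductSpace ℝ H] where
  /-- The domain `D(a)`. -/
  domain : Submodule ℝ H
  /-- The bilinear form. -/
  form : domain →ₗ[ℝ] domain →ₗ[ℝ] ℝ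
  nonneg : ∀ u, 0 ≤ form u u

/-- The space `D(a)`; it is a type of its own, so that it can carry the norm
`‖u‖ = a₁(u, u)^{1/2}`, `a₁ = a + (·, ·)_H`, instead of the norm of `H`. -/
def FormDomain (a : NonnegForm H) : Type _ := a.domain

namespace FormDomain

variable (a : NonnegForm H)

instance : AddCommGroup (FormDomain a) := inferInstanceAs (AddCommGroup a.domain)

instance : Module ℝ (FormDomain a) := inferInstanceAs (Module ℝ a.domain)

variable {a}

/-- The inclusion `D(a) ⊆ H`. -/
def toH : FormDomain a →ₗ[ℝ] H := a.domain.subtype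

/-- The symmetric part of `a₁ = a + (·, ·)_H` is an inner product on `D(a)`. -/
@[reducible] def innerCore : InnerProductSpace.Core ℝ (FormDomain a) where
  inner u v := (a.form u v + a.form v u) / 2 + inner ℝ (toH u) (toH v)
  conj_inner_symm u v := by
    simp only [conj_trivial]
    rw [real_inner_comm, add_comm (a.form v u)]
  re_inner_nonneg u := by
    have h1 : 0 ≤ a.form u u := a.nonneg u
    have h2 : 0 ≤ inner ℝ (toH u) (toH u) := real_inner_self_nonneg
    simp only [RCLike.re_to_real]
    linarith
  add_left u v w := by
    have h1 : a.form (u + v) w = a.form u w + a.form v w :=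
      LinearMap.map_add₂ a.form u v w
    have h2 : a.form w (u + v) = a.form w u + a.form w v := (a.form w).map_add u v
    rw [h1, h2, map_add, inner_add_left]
    ring
  smul_left u v r := by
    have h1 : a.form (r • u) v = r * a.form u v := LinearMap.map_smul₂ a.form r u v
    have h2 : a.form v (r • u) = r * a.form v u := (a.form v).map_smul r u
    rw [h1, h2, map_smul, real_inner_smul_left]
    simp only [conj_trivial]
    ring
  definite u hu := by
    have h1 : 0 ≤ a.form u u := a.nonneg u
    have h2 : 0 ≤ inner ℝ (toH u) (toH u) := real_inner_self_nonneg
    have h3 : inner ℝ (toH u) (toH u) = 0 := by linarith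
    exact Subtype.ext (inner_self_eq_zero.mp h3)

instance : NormedAddCommGroup (FormDomain a) :=
  @InnerProductSpace.Core.toNormedAddCommGroup ℝ (FormDomain a) _ _ _ innerCore

instance : InnerProductSpace ℝ (FormDomain a) := InnerProductSpace.ofCore innerCore.toCore

/-- The form `a_α(u, v) = a(u, v) + α (u, v)_H`. -/
def shift (α : ℝ) (u v : FormDomain a) : ℝ := a.form u v + α * inner ℝ (toH u) (toH v)

theorem norm_sq (u : FormDomain a) : ‖u‖ ^ 2 = shift 1 u u := by
  have h : inner ℝ u u = (a.form u u + a.form u u) / 2 + inner ℝ (toH u) (toH u) := rfl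
  rw [← real_inner_self_eq_norm_sq, h, shift]
  ring

theorem norm_toH_le (u : FormDomain a) : ‖toH u‖ ≤ ‖u‖ := by
  have h1 : 0 ≤ a.form u u := a.nonneg u
  have h2 := norm_sq u
  rw [shift, real_inner_self_eq_norm_sq] at h2
  exact le_of_sq_le_sq (by linarith) (norm_nonneg u)
where
  le_of_sq_le_sq {x y : ℝ} (h : x ^ 2 ≤ y ^ 2) (hy : 0 ≤ y) : x ≤ y := by
    nlinarith

/-- An element `h` of `H` as the bounded linear functional `v ↦ (h, v)_H` on `D(a)`
(the inclusion `H ⊆ D(a)'`). -/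
def functional (h : H) : StrongDual ℝ (FormDomain a) :=
  LinearMap.mkContinuous ((innerSL ℝ h).toLinearMap ∘ₗ toH) ‖h‖ fun v =>
    (norm_inner_le_norm h (toH v)).trans
      (mul_le_mul_of_nonneg_left (norm_toH_le v) (norm_nonneg h))

end FormDomain

open FormDomain

namespace NonnegForm

/-- `K` is a sector constant of `a`: `|a₁(u, v)| ≤ K a₁(u, u)^{1/2} a₁(v, v)^{1/2}`. -/
def IsSectorConst (a : NonnegForm H) (K : ℝ) : Prop :=
  0 < K ∧ ∀ u v : FormDomain a, |shift 1 u v| ≤ K * ‖u‖ * ‖v‖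

/-- Coercive closed forms: densely defined, closed, weak sector condition. -/
structure IsCoerciveClosed (a : NonnegForm H) : Prop where
  dense : Dense (a.domain : Set H)
  complete : CompleteSpace (FormDomain a)
  sector : ∃ K, a.IsSectorConst K

end NonnegForm

/-! ### Strongly continuous semigroups and the form `ℰ` -/

/-- `(T_t)_{t ≥ 0}` is a `C₀`-semigroup of bounded operators on `X`
(only the values at `t ≥ 0` matter). -/
structure IsC0Semigroup {X : Type*} [NormedAddCommGroup X] [NormedSpace ℝ X]
    (T : ℝ → X →L[ℝ] X) : Prop where
  zero : T 0 = ContinuousLinearMap.id ℝ X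
  add : ∀ s t, 0 ≤ s → 0 ≤ t → T (s + t) = (T s).comp (T t)
  tendsto : ∀ x, Tendsto (fun t => T t x) (𝓝[>] 0) (𝓝 x)

/-- The operator `(L, D(L))` is the generator of `(T_t)`. -/
def IsGeneratorOf {X : Type*} [NormedAddCommGroup X] [NormedSpace ℝ X]
    (L : X →ₗ.[ℝ] X) (T : ℝ → X →L[ℝ] X) : Prop :=
  ∀ x y : X, (x, y) ∈ L.graph ↔ Tendsto (fun t : ℝ => t⁻¹ • (T t x - x)) (𝓝[>] 0) (𝓝 y)

/-- The data that determine a (time dependent) form `ℰ` on `H`: a form `(𝒬, D(𝒬))` and an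
operator `(Λ, D(Λ, H))` on `H`. -/
structure FormPair (H : Type*) [NormedAddCommGroup H] [InnerProductSpace ℝ H] where
  /-- The form `(𝒬, D(𝒬))`. -/
  Q : NonnegForm H
  /-- The operator `(Λ, D(Λ, H))`. -/
  L : H →ₗ.[ℝ] H

namespace FormPair

variable (e : FormPair H)

/-- The space `D(𝒬)` with the norm `𝒬₁(u, u)^{1/2}`. -/
abbrev V : Type _ := FormDomain e.Q

/-- The hypotheses on `𝒬` and `Λ`: `𝒬` is a coercive closed form, and `Λ` generates a
`C₀`-semigroup of contractions on `H` that restricts to a `C₀`-semigroup on `D(𝒬)`. -/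
structure IsAdmissible : Prop where
  coerciveClosed : e.Q.IsCoerciveClosed
  semigroup : ∃ T : ℝ → H →L[ℝ] H, IsC0Semigroup T ∧ (∀ t, 0 ≤ t → ‖T t‖ ≤ 1) ∧
    IsGeneratorOf e.L T ∧
    ∃ S : ℝ → e.V →L[ℝ] e.V, IsC0Semigroup S ∧
      ∀ t, 0 ≤ t → ∀ v : e.V, toH (S t v) = T t (toH v)

/-- `Λ : D(Λ, H) ∩ D(𝒬) → D(𝒬)'` as a densely defined operator from `D(𝒬)` to `D(𝒬)'`. -/
def preLambda : e.V →ₗ.[ℝ] StrongDual ℝ e.V where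
  domain := e.L.domain.comap toH
  toFun :=
    { toFun := fun u => functional (e.L ⟨toH u.1, u.2⟩)
      map_add' := fun u v => by
        ext w
        have h : e.L ⟨toH (u + v).1, (u + v).2⟩
            = e.L ⟨toH u.1, u.2⟩ + e.L ⟨toH v.1, v.2⟩ := by
          rw [← e.L.map_add]
          rfl
        rw [h]
        exact inner_add_left _ _ _
      map_smul' := fun r u => by
        ext w
        have h : e.L ⟨toH (r • u).1, (r • u).2⟩ = r • e.L ⟨toH u.1, u.2⟩ := by
          rw [← e.L.map_smul]
          rfl
        rw [h]
        exact real_inner_smul_left _ _ _ }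

/-- `(Λ, ℱ)`: the closure of `Λ : D(Λ, H) ∩ D(𝒬) → D(𝒬)'` as an operator from `D(𝒬)` to
`D(𝒬)'`. (For admissible data this operator is closable.) -/
def Lambda : e.V →ₗ.[ℝ] StrongDual ℝ e.V := e.preLambda.closure

/-- The space `ℱ`. -/
abbrev F : Type _ := e.Lambda.domain

variable {e}

/-- The element of `H` given by an element of `ℱ ⊆ D(𝒬)`. -/
def F.toH (f : e.F) : H := FormDomain.toH (f : e.V)

/-- `‖f‖_ℱ = (‖f‖²_{D(𝒬)} + ‖Λf‖²_{D(𝒬)'})^{1/2}`. -/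
def F.fnorm (f : e.F) : ℝ := √(‖(f : e.V)‖ ^ 2 + ‖e.Lambda f‖ ^ 2)

variable (e)

/-- `ℰ_α(u, v) = 𝒬(u, v) - ⟨Λu, v⟩ + α (u, v)_H` for `u ∈ ℱ`, `v ∈ D(𝒬)`; `ℰ = ℰ₀`. -/
def form (α : ℝ) (u : e.F) (v : e.V) : ℝ :=
  shift α (u : e.V) v - e.Lambda u v

open Classical in
/-- The resolvent: for `α > 0`, `G_α f` is the element of `ℱ` with
`ℰ_α(G_α f, v) = (f, v)_H` for all `v ∈ D(𝒬)`. (It exists and is unique for admissible data;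
the value `0` is used where there is no such element.) -/
def resolvent (α : ℝ) (f : H) : H :=
  if h : ∃ u : e.F, ∀ v : e.V, e.form α u v = inner ℝ f (toH v) then F.toH h.choose else 0

end FormPair

end Forms

/-! ### Dirichlet forms on `L²(E, μ)` -/

section Dirichlet

open FormDomain

variable {E : Type*} [MeasurableSpace E] {μ : Measure E}

/-- Semi-Dirichlet forms on `L²(E, μ)`: coercive closed forms such that, for `u ∈ D(𝒜)`,
`w = u⁺ ∧ 1` belongs to `D(𝒜)` and `𝒜(u + w, u - w) ≥ 0`. -/
structure IsSemiDirichletForm (A : NonnegForm (Lp ℝ 2 μ)) : Prop where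
  coerciveClosed : A.IsCoerciveClosed
  unit_contraction : ∀ u : FormDomain A, ∃ w : FormDomain A,
    (∀ᵐ x ∂μ, toH w x = min (max (toH u x) 0) 1) ∧ 0 ≤ A.form (u + w) (u - w)

namespace FormPair

/-- Generalized Dirichlet forms on `L²(E, μ)`: the form `ℰ` of admissible data such that, for
`u ∈ ℱ`, `w = u⁺ ∧ 1` belongs to `D(𝒬)` and `ℰ(u, u - w) ≥ 0`. -/
structure IsGeneralizedDirichletForm (e : FormPair (Lp ℝ 2 μ)) : Prop where
  admissible : e.IsAdmissible
  unit_contraction : ∀ u : e.F, ∃ w : e.V,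
    (∀ᵐ x ∂μ, toH w x = min (max (F.toH u x) 0) 1) ∧ 0 ≤ e.form 0 u ((u : e.V) - w)

variable (e : FormPair (Lp ℝ 2 μ))

/-- `u ∈ L²(E, μ)` is 1-excessive with respect to `ℰ`. -/
def IsOneExcessive (u : Lp ℝ 2 μ) : Prop :=
  ∀ α : ℝ, 0 ≤ α → α • e.resolvent (α + 1) u ≤ u

/-- `w` is the 1-reduced function `u_U = e_{u·1_U}` of `u·1_U`: the least 1-excessive element of
`L²(E, μ)` that dominates `u·1_U`. -/
def IsReduced (U : Set E) (u w : Lp ℝ 2 μ) : Prop :=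
  IsLeast {v : Lp ℝ 2 μ | e.IsOneExcessive v ∧ ∀ᵐ x ∂μ, U.indicator u x ≤ v x} w

open Classical in
/-- The 1-reduced function `u_U` (with the value `0` where it does not exist). -/
def reduced (U : Set E) (u : Lp ℝ 2 μ) : Lp ℝ 2 μ :=
  if h : ∃ w, e.IsReduced U u w then h.choose else 0

/-- `(C1)` with the constant `C`: `ℱ ⊆ D(𝒜)` and `𝒜₁(u, u) ≤ C ℰ₁(u, u)` for `u ∈ ℱ`. -/
def C1 (A : NonnegForm (Lp ℝ 2 μ)) (C : ℝ) : Prop :=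
  0 < C ∧ ∀ u : e.F, ∃ w : FormDomain A, toH w = F.toH u ∧
    shift 1 w w ≤ C * e.form 1 u (u : e.V)

/-- `(C2)`: for some `γ > 0`, `G_γ` maps the bounded elements of `L²(E, μ)` onto a subset of
`D(𝒜)` that is dense in `D(𝒜)`. -/
def C2 (A : NonnegForm (Lp ℝ 2 μ)) : Prop :=
  ∃ γ : ℝ, 0 < γ ∧
    (∀ f : Lp ℝ 2 μ, MemLp f ∞ μ → e.resolvent γ f ∈ A.domain) ∧
    Dense {w : FormDomain A | ∃ f : Lp ℝ 2 μ, MemLp f ∞ μ ∧ toH w = e.resolvent γ f}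

variable [TopologicalSpace E]

/-- `ℰ`-nests: increasing sequences of closed sets `F_k` such that, for every 1-excessive
`u ∈ ℱ`, `u_{E ∖ F_k} → 0` strongly in `L²(E, μ)` and weakly in `D(𝒬)`. -/
def IsNest (S : ℕ → Set E) : Prop :=
  Monotone S ∧ (∀ k, IsClosed (S k)) ∧
    ∀ u : e.F, e.IsOneExcessive (F.toH u) →
      Tendsto (fun k => e.reduced (S k)ᶜ (F.toH u)) atTop (𝓝 0) ∧
      ∃ v : ℕ → e.V, (∀ k, toH (v k) = e.reduced (S k)ᶜ (F.toH u)) ∧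
        ∀ l : StrongDual ℝ e.V, Tendsto (fun k => l (v k)) atTop (𝓝 0)

end FormPair

/-- `𝒜`-nests of a semi-Dirichlet form: increasing sequences of closed sets `F_k` such that the
elements of `D(𝒜)` that vanish a.e. outside some `F_k` are dense in `D(𝒜)`. -/
def NonnegForm.IsNest [TopologicalSpace E] (A : NonnegForm (Lp ℝ 2 μ)) (S : ℕ → Set E) : Prop :=
  Monotone S ∧ (∀ k, IsClosed (S k)) ∧
    Dense {w : FormDomain A | ∃ k, ∀ᵐ x ∂μ, x ∈ (S k)ᶜ → toH w x = 0}

end Dirichlet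

end

/-! The heart is an energy estimate. For a 1-excessive `u` with `u ≤ f ∈ ℱ` put `v = n G_{n+1} u`.
Then `ℰ₁(v, ·) = n (u - v, ·)` and `v ≤ u ≤ f`, so pairing the nonnegative elements `u - v` and `f -
v` gives `ℰ₁(v, v) ≤ ℰ₁(v, f)`. The sector condition controls the `𝒬` part of the right side, but
`⟨Λv, f⟩` is not controlled by `‖v‖_{D(𝒬)}`. Since `-Λ` has a nonnegative symmetric part,
Cauchy-Schwarz exchanges `⟨Λv, f⟩` for `⟨Λf, v⟩` up to `2 ⟨-Λv, v⟩^{1/2} ⟨-Λf, f⟩^{1/2}`, and `⟨-Λv,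
v⟩` is absorbed by `ℰ₁(v, v)` (`form_self_le`). Hence `ℰ₁(v, v)` is bounded uniformly in `n`. By
(C1) so is `‖v‖_{D(𝒜)}`, and `n G_{n+1} u → u` in `L²` places `u` in `D(𝒜)` with the same bound
(`exists_toH_eq_of_isOneExcessive`). This is (i).

For (ii), the 1-excessive majorants of `u·1_U` form a closed convex set that is stable under infima.
Its element of minimal norm is therefore its least element `u_U` (`exists_isReduced`). As `u_U ≤ u ≤
f`, the estimate applies to `u_U`.

For (iii), take `u = G₁h` with `h ≥ 0`. The reduced functions `u_{E ∖ F_k}` are bounded in `D(𝒜)`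
and tend to `0` in `L²`, hence weakly in `D(𝒜)`. As `u - u_{E ∖ F_k}` vanishes off `F_k`, `u` lies
in the closure of the functions vanishing off some `F_k` (`mem_closure_vanishing`). The resolvent
equation and (C2) make differences of such `u` dense.

All this rests on the resolvent: it exists by a Lions type theorem, because `Λ` is dissipative, and
it is positive by the unit contraction property. -/

/-! ### Weak compactness in Hilbert spaces -/

section WeakLimits

variable {X H : Type*} [NormedAddCommGroup X] [InnerProductSpace ℝ X] [CompleteSpace X]
  [NormedAddCommGroup H] [InnerProductSpace ℝ H]

/-- A norm bounded family in a Hilbert space has a weak limit along every ultrafilter. -/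
theorem exists_weak_limit_of_bounded {ι : Type*} (𝒰 : Ultrafilter ι) {v : ι → X} {R : ℝ}
    (hv : ∀ᶠ i in (𝒰 : Filter ι), ‖v i‖ ≤ R) :
    ∃ x : X, ‖x‖ ≤ R ∧ ∀ l : StrongDual ℝ X, Tendsto (fun i => l (v i)) 𝒰 (𝓝 (l x)) := by
  -- Riesz duality carries the family to the dual, where Banach-Alaoglu applies. Ultrafilters
  -- replace subsequences, so no separability is needed.
  let D := InnerProductSpace.toDual ℝ X
  have hc := WeakDual.isCompact_closedBall (𝕜 := ℝ) (0 : StrongDual ℝ X) R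
  let φ : ι → WeakDual ℝ X := fun i => StrongDual.toWeakDual (D (v i))
  have hφ : ((𝒰.map φ : Ultrafilter (WeakDual ℝ X)) : Filter (WeakDual ℝ X)) ≤
      𝓟 (WeakDual.toStrongDual ⁻¹' Metric.closedBall (0 : StrongDual ℝ X) R) := by
    rw [le_principal_iff, Ultrafilter.coe_map, mem_map]
    filter_upwards [hv] with i hi
    simpa [φ, D] using hi
  obtain ⟨ξ, hξ, hlim⟩ := hc.ultrafilter_le_nhds _ hφ
  refine ⟨D.symm (WeakDual.toStrongDual ξ), ?_, fun l => ?_⟩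
  · simpa [D] using hξ
  · have h1 : Tendsto φ 𝒰 (𝓝 ξ) := hlim
    have h2 := (WeakDual.eval_continuous (𝕜 := ℝ) (E := X) (D.symm l)).tendsto ξ |>.comp h1
    have h3 : ∀ x : X, l x = inner ℝ x (D.symm l) := fun x => by
      rw [real_inner_comm]
      exact (InnerProductSpace.toDual_symm_apply).symm
    have h4 : l (D.symm (WeakDual.toStrongDual ξ)) = ξ (D.symm l) := by
      rw [h3]
      exact InnerProductSpace.toDual_symm_apply
    rw [h4]
    refine h2.congr fun i => ?_
    rw [h3]
    rfl

/-- If `v i` is bounded in the Hilbert space `X` and `j (v i)` converges in `H`, then the limit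
is in the range of `j`. -/
theorem exists_preimage_of_bounded_of_tendsto {ι : Type*} {l : Filter ι} [l.NeBot]
    (j : X →L[ℝ] H) {v : ι → X} {R : ℝ} (hv : ∀ᶠ i in l, ‖v i‖ ≤ R) {u : H}
    (hu : Tendsto (fun i => j (v i)) l (𝓝 u)) : ∃ x : X, j x = u ∧ ‖x‖ ≤ R := by
  obtain ⟨x, hx, hlim⟩ := exists_weak_limit_of_bounded (Ultrafilter.of l)
    (hv.filter_mono (Ultrafilter.of_le l))
  refine ⟨x, ?_, hx⟩
  refine ext_inner_left ℝ fun h => ?_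
  have h1 := hlim ((innerSL ℝ h).comp j)
  have h2 := (tendsto_const_nhds (x := h)).inner (𝕜 := ℝ) (hu.mono_left (Ultrafilter.of_le l))
  exact tendsto_nhds_unique h1 h2

/-- If `v i` is bounded in the Hilbert space `X`, `j` is injective and `j (v i) → 0` in `H`,
then `v i → 0` weakly. -/
theorem tendsto_weak_zero_of_bounded {ι : Type*} {l : Filter ι}
    (j : X →L[ℝ] H) (hj : Function.Injective j) {v : ι → X} {R : ℝ} (hv : ∀ᶠ i in l, ‖v i‖ ≤ R)
    (hu : Tendsto (fun i => j (v i)) l (𝓝 0)) (φ : StrongDual ℝ X) :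
    Tendsto (fun i => φ (v i)) l (𝓝 0) := by
  rw [tendsto_iff_ultrafilter]
  intro 𝒰 h𝒰
  obtain ⟨x, -, hlim⟩ := exists_weak_limit_of_bounded 𝒰 (hv.filter_mono h𝒰)
  have hx : x = 0 := by
    apply hj
    rw [map_zero]
    refine ext_inner_left ℝ fun h => ?_
    have h1 := hlim ((innerSL ℝ h).comp j)
    have h2 := (tendsto_const_nhds (x := h)).inner (𝕜 := ℝ) (hu.mono_left h𝒰)
    exact tendsto_nhds_unique h1 h2
  simpa [hx] using hlim φ

end WeakLimits

/-! ### Strongly continuous semigroups and their generators -/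

section Semigroups

variable {X : Type*} [NormedAddCommGroup X] [NormedSpace ℝ X]

namespace IsC0Semigroup

variable {T : ℝ → X →L[ℝ] X}

/-- Otherwise there are times `t n → 0` with unbounded `‖T (t n)‖`, while every orbit converges
along them, against Banach-Steinhaus. It is needed for the semigroup on `D(𝒬)`, which is not assumed
contractive. -/
theorem exists_bound [CompleteSpace X] (hT : IsC0Semigroup T) :
    ∃ δ > 0, ∃ M, ∀ t, 0 ≤ t → t ≤ δ → ‖T t‖ ≤ M := by
  by_contra! hcon
  have h1 : ∀ n : ℕ, ∃ t, 0 ≤ t ∧ t ≤ 1 / ((n : ℝ) + 1) ∧ (n : ℝ) + 1 < ‖T t‖ := fun n =>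
    hcon _ (by positivity) _
  choose t ht0 ht1 ht2 using h1
  have hpos : ∀ n, 0 < t n := fun n => by
    refine (ht0 n).lt_of_ne fun h => ?_
    have h2 := ht2 n
    rw [← h, hT.zero] at h2
    have h3 : ‖ContinuousLinearMap.id ℝ X‖ ≤ 1 := ContinuousLinearMap.norm_id_le
    have h4 : (0 : ℝ) ≤ n := n.cast_nonneg
    linarith
  have hlim : Tendsto t atTop (𝓝[>] 0) :=
    tendsto_nhdsWithin_iff.2 ⟨squeeze_zero ht0 ht1 tendsto_one_div_add_atTop_nhds_zero_nat,
      Eventually.of_forall hpos⟩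
  obtain ⟨C, hC⟩ := banach_steinhaus (g := fun n => T (t n)) fun x => by
    obtain ⟨C, hC⟩ := ((hT.tendsto x).comp hlim).norm.bddAbove_range
    exact ⟨C, fun n => hC ⟨n, rfl⟩⟩
  obtain ⟨n, hn⟩ := exists_nat_gt C
  have := hC n
  have := ht2 n
  linarith

theorem norm_sub_le (hT : IsC0Semigroup T) {M : ℝ} {s t : ℝ} (hs : 0 ≤ s) (hst : s ≤ t)
    (hM : ‖T s‖ ≤ M) (x : X) : ‖T t x - T s x‖ ≤ M * ‖T (t - s) x - x‖ := by
  have h : T t x = T s (T (t - s) x) := by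
    have := hT.add s (t - s) hs (sub_nonneg.2 hst)
    rw [add_sub_cancel] at this
    rw [this]
    rfl
  rw [h, ← map_sub]
  exact ((T s).le_opNorm _).trans (by gcongr)

theorem continuousOn (hT : IsC0Semigroup T) {s : Set ℝ} (hs : s ⊆ Set.Ici 0) {M : ℝ}
    (hM : ∀ t ∈ s, ‖T t‖ ≤ M) (x : X) : ContinuousOn (fun t => T t x) s := by
  intro t ht
  have h0 : Tendsto (fun r => T r x) (𝓝[≥] 0) (𝓝 x) := by
    rw [← Set.Ioi_insert, nhdsWithin_insert]
    refine Tendsto.sup ?_ (hT.tendsto x)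
    rw [tendsto_pure_left]
    intro U hU
    rw [hT.zero]
    exact mem_of_mem_nhds hU
  have h1 : Tendsto (fun r => |r - t|) (𝓝[s] t) (𝓝[≥] 0) := by
    refine tendsto_nhdsWithin_iff.2 ⟨?_, Eventually.of_forall fun r => Set.mem_Ici.2 (abs_nonneg _)⟩
    have : Continuous fun r : ℝ => |r - t| := by fun_prop
    simpa using (this.tendsto t).mono_left nhdsWithin_le_nhds
  have h2 : Tendsto (fun r => M * ‖T |r - t| x - x‖) (𝓝[s] t) (𝓝 0) := by
    simpa using (((h0.comp h1).sub_const x).norm.const_mul M)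
  refine tendsto_iff_norm_sub_tendsto_zero.2 (squeeze_zero' (Eventually.of_forall fun _ =>
    norm_nonneg _) ?_ h2)
  filter_upwards [self_mem_nhdsWithin] with r hr
  rcases le_total t r with h | h
  · rw [abs_of_nonneg (sub_nonneg.2 h)]
    exact hT.norm_sub_le (hs ht) h (hM t ht) x
  · rw [abs_of_nonpos (sub_nonpos.2 h), neg_sub, norm_sub_rev]
    exact hT.norm_sub_le (hs hr) h (hM r hr) x

/-- Averages of orbits of a contraction semigroup are in the domain of the generator. -/
theorem integral_mem_graph [CompleteSpace X] (hT : IsC0Semigroup T)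
    (hc : ∀ t, 0 ≤ t → ‖T t‖ ≤ 1) {L : X →ₗ.[ℝ] X} (hL : IsGeneratorOf L T) (x : X) {h : ℝ}
    (hh : 0 ≤ h) : (∫ s in (0 : ℝ)..h, T s x, T h x - x) ∈ L.graph := by
  have hcont : ContinuousOn (fun t => T t x) (Set.Ici 0) := hT.continuousOn subset_rfl hc x
  -- The orbit is frozen at negative times, so that its primitive is differentiable on all of `ℝ`.
  let φ : ℝ → X := fun s => T (max s 0) x
  have hφ : Continuous φ := hcont.comp_continuous (by fun_prop) fun s => Set.mem_Ici.2 (le_max_right _ _)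
  have hφT : ∀ s, 0 ≤ s → φ s = T s x := fun s hs => by simp only [φ, max_eq_left hs]
  have hint : ∀ a b, IntervalIntegrable φ volume a b := fun a b => hφ.intervalIntegrable a b
  have hcongr : ∫ s in (0 : ℝ)..h, T s x = ∫ s in (0 : ℝ)..h, φ s := by
    refine intervalIntegral.integral_congr fun s hs => ?_
    rw [Set.uIcc_of_le hh] at hs
    exact (hφT s hs.1).symm
  let Φ : ℝ → X := fun t => ∫ s in (0 : ℝ)..t, φ s
  have hΦ : ∀ t, HasDerivAt Φ (φ t) t := fun t =>
    intervalIntegral.integral_hasDerivAt_right (hint 0 t)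
      hφ.stronglyMeasurable.stronglyMeasurableAtFilter hφ.continuousAt
  have hΦ' : ∀ r, Tendsto (fun t : ℝ => t⁻¹ • (Φ (r + t) - Φ r)) (𝓝[>] 0) (𝓝 (φ r)) := fun r =>
    (hasDerivAt_iff_tendsto_slope_zero.1 (hΦ r)).mono_left (nhdsGT_le_nhdsNE 0)
  have hlim := (hΦ' h).sub (hΦ' 0)
  rw [hφT h hh, hφT 0 le_rfl, hT.zero] at hlim
  rw [hL, hcongr]
  refine hlim.congr' ?_
  filter_upwards [self_mem_nhdsWithin] with t ht
  have ht : 0 < t := ht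
  have e1 : T t (Φ h) = ∫ s in (0 : ℝ)..h, φ (s + t) := by
    rw [← ContinuousLinearMap.intervalIntegral_comp_comm _ (hint 0 h)]
    refine intervalIntegral.integral_congr fun s hs => ?_
    rw [Set.uIcc_of_le hh] at hs
    rw [hφT s hs.1, hφT (s + t) (by linarith [hs.1]), add_comm, hT.add t s ht.le hs.1]
    rfl
  have e2 : T t (Φ h) = Φ (h + t) - Φ (0 + t) := by
    rw [e1, intervalIntegral.integral_comp_add_right]
    exact (intervalIntegral.integral_interval_sub_left (hint _ _) (hint _ _)).symm
  have e3 : Φ 0 = 0 := intervalIntegral.integral_same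
  change _ = t⁻¹ • (T t (Φ h) - Φ h)
  rw [e2, e3, ← smul_sub]
  congr 1
  abel

end IsC0Semigroup

/-- The generator of a contraction semigroup on a Hilbert space is dissipative. -/
theorem IsGeneratorOf.inner_le_zero {H : Type*} [NormedAddCommGroup H] [InnerProductSpace ℝ H]
    {T : ℝ → H →L[ℝ] H} (hc : ∀ t, 0 ≤ t → ‖T t‖ ≤ 1) {L : H →ₗ.[ℝ] H}
    (hL : IsGeneratorOf L T) (x : L.domain) : inner ℝ (L x) (x : H) ≤ 0 := by
  have h1 := (hL _ _).1 (L.mem_graph x)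
  refine le_of_tendsto (h1.inner (𝕜 := ℝ) (tendsto_const_nhds (x := (x : H)))) ?_
  filter_upwards [self_mem_nhdsWithin] with t ht
  have ht : 0 < t := ht
  rw [real_inner_smul_left]
  exact mul_nonpos_of_nonneg_of_nonpos (by positivity) (inner_sub_self_le_zero (hc t ht.le) _)
where
  inner_sub_self_le_zero {R : H →L[ℝ] H} (hR : ‖R‖ ≤ 1) (x : H) : inner ℝ (R x - x) x ≤ 0 := by
    rw [inner_sub_left, real_inner_self_eq_norm_sq]
    have h1 : ‖R x‖ ≤ ‖x‖ := (R.le_of_opNorm_le hR x).trans (one_mul _).le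
    nlinarith [real_inner_le_norm (R x) x, norm_nonneg x]

end Semigroups

/-! ### Continuity and coercivity of the shifted forms -/

section FormDomains

variable {H : Type*} [NormedAddCommGroup H] [InnerProductSpace ℝ H]

namespace FormDomain

variable {a : NonnegForm H}

/-- The inclusion `D(a) ⊆ H` as a bounded operator. -/
noncomputable def toHL (a : NonnegForm H) : FormDomain a →L[ℝ] H :=
  LinearMap.mkContinuous toH 1 fun u => (norm_toH_le u).trans (one_mul _).ge

@[simp] theorem toHL_apply (u : FormDomain a) : toHL a u = toH u := rfl

theorem toH_injective : Function.Injective (toH : FormDomain a → H) := Subtype.val_injective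

theorem toH_mem (u : FormDomain a) : toH u ∈ a.domain := u.2

theorem denseRange_toH (ha : a.IsCoerciveClosed) : DenseRange (toH : FormDomain a → H) := by
  have h : Set.range (toH : FormDomain a → H) = (a.domain : Set H) := Subtype.range_val
  rw [DenseRange, h]
  exact ha.dense

theorem shift_add_left (α : ℝ) (u v w : FormDomain a) :
    shift α (u + v) w = shift α u w + shift α v w := by
  have h : a.form (u + v) w = a.form u w + a.form v w := LinearMap.map_add₂ a.form u v w
  simp only [shift, h, map_add, inner_add_left]
  ring

theorem shift_add_right (α : ℝ) (u v w : FormDomain a) :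
    shift α u (v + w) = shift α u v + shift α u w := by
  have h : a.form u (v + w) = a.form u v + a.form u w := (a.form u).map_add v w
  simp only [shift, h, map_add, inner_add_right]
  ring

theorem shift_smul_left (α r : ℝ) (u v : FormDomain a) :
    shift α (r • u) v = r * shift α u v := by
  have h : a.form (r • u) v = r * a.form u v := LinearMap.map_smul₂ a.form r u v
  simp only [shift, h, map_smul, real_inner_smul_left]
  ring

theorem shift_smul_right (α r : ℝ) (u v : FormDomain a) :
    shift α u (r • v) = r * shift α u v := by
  have h : a.form u (r • v) = r * a.form u v := (a.form u).map_smul r v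
  simp only [shift, h, map_smul, real_inner_smul_right]
  ring

theorem shift_eq_shift_add (α β : ℝ) (u v : FormDomain a) :
    shift α u v = shift β u v + (α - β) * inner ℝ (toH u) (toH v) := by
  simp only [shift]
  ring

theorem min_mul_norm_sq_le_shift (α : ℝ) (u : FormDomain a) :
    min 1 α * ‖u‖ ^ 2 ≤ shift α u u := by
  have h1 : 0 ≤ a.form u u := a.nonneg u
  have h2 : 0 ≤ inner ℝ (toH u) (toH u) := real_inner_self_nonneg
  rw [norm_sq, shift, shift]
  nlinarith [min_le_left 1 α, min_le_right 1 α]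

theorem one_le_sectorConst {K : ℝ} (hK : a.IsSectorConst K) {u : FormDomain a} (hu : u ≠ 0) :
    1 ≤ K := by
  have h1 := (le_abs_self _).trans (hK.2 u u)
  rw [← norm_sq] at h1
  have h2 : 0 < ‖u‖ := norm_pos_iff.2 hu
  by_contra! h
  nlinarith [mul_pos h2 h2]

theorem abs_shift_le {K : ℝ} (hK : a.IsSectorConst K) (α : ℝ) (u v : FormDomain a) :
    |shift α u v| ≤ (K + |α - 1|) * ‖u‖ * ‖v‖ := by
  rw [shift_eq_shift_add α 1]
  have h1 := hK.2 u v
  have h2 : |inner ℝ (toH u) (toH v)| ≤ ‖u‖ * ‖v‖ :=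
    (abs_real_inner_le_norm _ _).trans (by gcongr <;> exact norm_toH_le _)
  calc |shift 1 u v + (α - 1) * inner ℝ (toH u) (toH v)|
      ≤ |shift 1 u v| + |α - 1| * |inner ℝ (toH u) (toH v)| := by
        rw [← abs_mul]; exact abs_add_le _ _
    _ ≤ K * ‖u‖ * ‖v‖ + |α - 1| * (‖u‖ * ‖v‖) := by gcongr
    _ = _ := by ring

/-- The form `a_α` as a bounded operator `D(a) → D(a)'`. -/
noncomputable def shiftL {K : ℝ} (hK : a.IsSectorConst K) (α : ℝ) :
    FormDomain a →L[ℝ] StrongDual ℝ (FormDomain a) :=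
  LinearMap.mkContinuous₂
    (LinearMap.mk₂ ℝ (shift α) (shift_add_left α) (fun r u v => shift_smul_left α r u v)
      (shift_add_right α) (fun r u v => shift_smul_right α r u v))
    (K + |α - 1|) (fun u v => by simpa using abs_shift_le hK α u v)

@[simp] theorem shiftL_apply {K : ℝ} (hK : a.IsSectorConst K) (α : ℝ) (u v : FormDomain a) :
    shiftL hK α u v = shift α u v := rfl

end FormDomain

end FormDomains

/-! ### Dissipative operators from a space to its dual -/

section Dissipative

variable {X : Type*} [NormedAddCommGroup X] [NormedSpace ℝ X]

/-- The closure of the graph of a dissipative operator `X → X'` is dissipative. -/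
theorem apply_self_nonpos_of_mem_closure {P : X →ₗ.[ℝ] StrongDual ℝ X}
    (hP : ∀ x : P.domain, P x (x : X) ≤ 0) {p : X × StrongDual ℝ X}
    (hp : p ∈ P.graph.topologicalClosure) : p.2 p.1 ≤ 0 := by
  have hcl : IsClosed {p : X × StrongDual ℝ X | p.2 p.1 ≤ 0} :=
    isClosed_le (by fun_prop) continuous_const
  refine hcl.closure_subset_iff.2 ?_ hp
  rintro ⟨x, l⟩ hx
  obtain ⟨y, hy1, hy2⟩ := (LinearPMap.mem_graph_iff P).1 hx
  simp only at hy1 hy2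
  simpa [← hy1, ← hy2] using hP y

/-- A densely defined dissipative operator `X → X'` is closable. -/
theorem LinearPMap.isClosable_of_dissipative {P : X →ₗ.[ℝ] StrongDual ℝ X}
    (hP : ∀ x : P.domain, P x (x : X) ≤ 0) (hd : Dense (P.domain : Set X)) : P.IsClosable := by
  have key : ∀ p ∈ P.graph.topologicalClosure, p.1 = 0 → p.2 = 0 := by
    rintro ⟨x, l⟩ hp hx
    simp only at hx
    subst hx
    have h1 : ∀ v : P.domain, l v = 0 := fun v => by
      -- Dissipativity at `(0, l) + r (v, Pv)` gives a quadratic in `r` without constant term. It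
      -- can stay nonpositive only if its linear coefficient `l v` is zero.
      have h2 : ∀ r : ℝ, r * l v + r ^ 2 * P v v ≤ 0 := fun r => by
        have hv : ((v : X), P v) ∈ P.graph.topologicalClosure :=
          P.graph.le_topologicalClosure (P.mem_graph v)
        have h3 := apply_self_nonpos_of_mem_closure hP
          (Submodule.add_mem _ hp (Submodule.smul_mem _ r hv))
        have h4 : ((0, l) + r • ((v : X), P v)).2 ((0, l) + r • ((v : X), P v)).1
            = r * l v + r ^ 2 * P v v := by
          simp
          ring
        rwa [h4] at h3
      have h5 := hP v
      by_contra hne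
      by_cases h0 : P v v = 0
      · have := h2 (l v)
        rw [h0] at this
        nlinarith [mul_self_pos.2 hne]
      · have h6 : 0 < -P v v := by
          rcases h5.lt_or_eq with h | h
          · linarith
          · exact absurd h h0
        have h7 := h2 (l v / (-2 * P v v))
        have h8 : l v / (-2 * P v v) * l v + (l v / (-2 * P v v)) ^ 2 * P v v
            = (l v) ^ 2 / (4 * (-P v v)) := by
          field_simp
          ring
        rw [h8] at h7
        have : 0 < (l v) ^ 2 / (4 * (-P v v)) := by positivity
        linarith
    exact ContinuousLinearMap.coeFn_injective
      (Continuous.ext_on hd l.continuous (0 : StrongDual ℝ X).continuous fun v hv => h1 ⟨v, hv⟩)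
  exact ⟨_, (Submodule.toLinearPMap_graph_eq _ fun p hp h => key p hp h).symm⟩

theorem norm_le_of_coercive_of_nonpos (B : X →L[ℝ] StrongDual ℝ X) {c : ℝ} (hc : 0 < c)
    {x : X} (hB : c * ‖x‖ ^ 2 ≤ B x x) {l : StrongDual ℝ X} (hl : l x ≤ 0) :
    ‖x‖ ≤ c⁻¹ * ‖B x - l‖ := by
  have h3 := (le_abs_self _).trans ((B x - l).le_opNorm x)
  rw [sub_apply] at h3
  rw [le_inv_mul_iff₀ hc]
  rcases (norm_nonneg x).eq_or_lt with h0 | h0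
  · rw [← h0, mul_zero]
    exact norm_nonneg _
  · refine le_of_mul_le_mul_right ?_ h0
    nlinarith

/-- A priori estimate: `c ‖x‖² ≤ B x x ≤ (B x - l) x` bounds `x`, and then `l = B x - (B x - l)` is
bounded too. It makes `B - P` bounded below on its graph, which closes the range. -/
theorem norm_prod_le_of_coercive_of_nonpos (B : X →L[ℝ] StrongDual ℝ X) {c : ℝ} (hc : 0 < c)
    {x : X} (hB : c * ‖x‖ ^ 2 ≤ B x x) {l : StrongDual ℝ X} (hl : l x ≤ 0) :
    ‖(x, l)‖ ≤ (c⁻¹ + ‖B‖ * c⁻¹ + 1) * ‖B x - l‖ := by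
  have h1 := norm_le_of_coercive_of_nonpos B hc hB hl
  have h2 : ‖l‖ ≤ ‖B‖ * (c⁻¹ * ‖B x - l‖) + ‖B x - l‖ := by
    have h3 : ‖l‖ ≤ ‖B x‖ + ‖B x - l‖ := by
      simpa using norm_sub_le (B x) (B x - l)
    have h4 : ‖B x‖ ≤ ‖B‖ * (c⁻¹ * ‖B x - l‖) := (B.le_opNorm x).trans (by gcongr)
    linarith
  have h4 : 0 ≤ c⁻¹ * ‖B x - l‖ := by positivity
  have h5 : 0 ≤ ‖B‖ * (c⁻¹ * ‖B x - l‖) := by positivity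
  have h6 := norm_nonneg (B x - l)
  rw [Prod.norm_mk]
  exact max_le (by linarith) (by linarith)

theorem isClosed_image_sub_of_bound {W : Type*} [NormedAddCommGroup W] [NormedSpace ℝ W]
    [CompleteSpace X] [CompleteSpace W] {G : Submodule ℝ (X × W)} (hG : IsClosed (G : Set (X × W)))
    (B : X →L[ℝ] W) {K : ℝ} (hK : ∀ p ∈ G, ‖p‖ ≤ K * ‖B p.1 - p.2‖) :
    IsClosed (Submodule.map (B.toLinearMap ∘ₗ LinearMap.fst ℝ X W - LinearMap.snd ℝ X W) G :
      Set W) := by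
  have : CompleteSpace G := hG.completeSpace_coe
  let g : G →L[ℝ] W :=
    (B.comp (ContinuousLinearMap.fst ℝ X W) - ContinuousLinearMap.snd ℝ X W).comp G.subtypeL
  have h1 : AntilipschitzWith K.toNNReal g := g.antilipschitz_of_bound fun p =>
    (hK p p.2).trans (mul_le_mul_of_nonneg_right (Real.le_coe_toNNReal K) (norm_nonneg _))
  have h2 := h1.isClosed_range g.uniformContinuous
  convert h2 using 1
  ext w
  constructor
  · rintro ⟨p, hp, rfl⟩
    exact ⟨⟨p, hp⟩, rfl⟩
  · rintro ⟨p, rfl⟩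
    exact ⟨p, p.2, rfl⟩

/-- A Lions type existence theorem: if `P : X → X'` is dissipative with closed graph, `B` is a
coercive bounded operator and the range of `B - P` separates points, then `B - P` is onto. -/
theorem exists_sub_eq_of_dissipative {X : Type*} [NormedAddCommGroup X] [InnerProductSpace ℝ X]
    [CompleteSpace X] {P : X →ₗ.[ℝ] StrongDual ℝ X} (hP : ∀ x : P.domain, P x (x : X) ≤ 0)
    (hcl : P.IsClosed) (B : X →L[ℝ] StrongDual ℝ X) {c : ℝ} (hc : 0 < c)
    (hB : ∀ x, c * ‖x‖ ^ 2 ≤ B x x)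
    (hsep : ∀ v : X, (∀ u : P.domain, (B u - P u) v = 0) → v = 0) (l : StrongDual ℝ X) :
    ∃ u : P.domain, B u - P u = l := by
  let D := InnerProductSpace.toDual ℝ X
  have hrange := isClosed_image_sub_of_bound hcl B (K := c⁻¹ + ‖B‖ * c⁻¹ + 1) fun p hp =>
    norm_prod_le_of_coercive_of_nonpos B hc (hB _)
      (apply_self_nonpos_of_mem_closure hP (P.graph.le_topologicalClosure hp))
  let R : Submodule ℝ X := (Submodule.map (B.toLinearMap ∘ₗ LinearMap.fst ℝ X _ -
    LinearMap.snd ℝ X _) P.graph).comap D.toLinearEquiv.toLinearMap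
  have hR : IsClosed (R : Set X) := hrange.preimage D.continuous
  have : CompleteSpace R := hR.completeSpace_coe
  have htop : R = ⊤ := by
    rw [← Submodule.orthogonal_eq_bot_iff, Submodule.eq_bot_iff]
    intro v hv
    refine hsep v fun u => ?_
    have h1 : inner ℝ (D.symm (B u - P u)) v = 0 :=
      hv _ ⟨_, P.mem_graph u, (D.apply_symm_apply _).symm⟩
    rwa [InnerProductSpace.toDual_symm_apply] at h1
  obtain ⟨p, hpG, hp⟩ : D.symm l ∈ R := htop ▸ Submodule.mem_top
  obtain ⟨u, hu1, hu2⟩ := (LinearPMap.mem_graph_iff P).1 hpG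
  refine ⟨u, ?_⟩
  have h1 : B p.1 - p.2 = l := hp.trans (D.apply_symm_apply l)
  rw [← h1, hu1, hu2]

end Dissipative

/-! ### Existence and strong continuity of the resolvent -/

section Resolvent

open FormDomain

variable {H : Type*} [NormedAddCommGroup H] [InnerProductSpace ℝ H]

namespace FormPair

variable {e : FormPair H}

theorem preLambda_apply (u : e.preLambda.domain) (v : e.V) :
    e.preLambda u v = inner ℝ (e.L ⟨toH (u : e.V), u.2⟩) (toH v) := rfl

theorem form_add_left (α : ℝ) (u u' : e.F) (v : e.V) :
    e.form α (u + u') v = e.form α u v + e.form α u' v := by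
  simp only [form, Submodule.coe_add, shift_add_left, LinearPMap.map_add, add_apply]
  ring

theorem form_smul_left (α r : ℝ) (u : e.F) (v : e.V) :
    e.form α (r • u) v = r * e.form α u v := by
  simp only [form, Submodule.coe_smul, shift_smul_left, LinearPMap.map_smul, smul_apply,
    smul_eq_mul]
  ring

theorem form_sub_left (α : ℝ) (u u' : e.F) (v : e.V) :
    e.form α (u - u') v = e.form α u v - e.form α u' v := by
  rw [sub_eq_add_neg, ← neg_one_smul ℝ, form_add_left, form_smul_left]
  ring

theorem form_smul_right (α r : ℝ) (u : e.F) (v : e.V) :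
    e.form α u (r • v) = r * e.form α u v := by
  simp only [form, shift_smul_right, map_smul, smul_eq_mul]
  ring

theorem form_eq_form_add (α β : ℝ) (u : e.F) (v : e.V) :
    e.form α u v = e.form β u v + (α - β) * inner ℝ (F.toH u) (toH v) := by
  simp only [form, shift_eq_shift_add α β, F.toH]
  ring

@[simp] theorem F.toH_add (u v : e.F) : F.toH (u + v) = F.toH u + F.toH v := rfl

@[simp] theorem F.toH_smul (r : ℝ) (u : e.F) : F.toH (r • u) = r • F.toH u := rfl

namespace IsAdmissible

theorem preLambda_self_nonpos (he : e.IsAdmissible) (u : e.preLambda.domain) :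
    e.preLambda u (u : e.V) ≤ 0 := by
  obtain ⟨T, -, hc, hL, -⟩ := he.semigroup
  exact hL.inner_le_zero hc ⟨toH (u : e.V), u.2⟩

variable [CompleteSpace H]

/-- Every `v ∈ D(𝒬)` is approximated in `D(𝒬)` by averages `u` of its orbit, and
`(Λu, v) ≤ 0`. -/
theorem exists_tendsto_preLambda (he : e.IsAdmissible) (v : e.V) :
    ∃ u : ℕ → e.preLambda.domain, Tendsto (fun n => (u n : e.V)) atTop (𝓝 v) ∧
      ∀ n, e.preLambda (u n) v ≤ 0 := by
  obtain ⟨T, hT, hc, hL, S, hS, hST⟩ := he.semigroup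
  have := he.coerciveClosed.complete
  obtain ⟨δ, hδ, M, hM⟩ := hS.exists_bound
  have hcont : ContinuousOn (fun t => S t v) (Set.Icc 0 δ) :=
    hS.continuousOn (fun t ht => ht.1) (fun t ht => hM t ht.1 ht.2) v
  -- Times are clamped to `[0, δ]`, where the operators `S t` are uniformly bounded.
  let ψ : ℝ → e.V := fun s => S (min (max s 0) δ) v
  have hψ : Continuous ψ := hcont.comp_continuous (by fun_prop) fun s =>
    ⟨le_min (le_max_right _ _) hδ.le, min_le_right _ _⟩
  have hψS : ∀ s, 0 ≤ s → s ≤ δ → ψ s = S s v := fun s hs hs' => by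
    simp only [ψ, max_eq_left hs, min_eq_left hs']
  let Ψ : ℝ → e.V := fun t => ∫ s in (0 : ℝ)..t, ψ s
  have hΨ : Tendsto (fun t : ℝ => t⁻¹ • Ψ t) (𝓝[>] 0) (𝓝 v) := by
    have h1 : HasDerivAt Ψ (ψ 0) 0 := intervalIntegral.integral_hasDerivAt_right
      (hψ.intervalIntegrable _ _) hψ.stronglyMeasurable.stronglyMeasurableAtFilter
      hψ.continuousAt
    have h2 := (hasDerivAt_iff_tendsto_slope_zero.1 h1).mono_left (nhdsGT_le_nhdsNE 0)
    have h3 : ψ 0 = v := by rw [hψS 0 le_rfl hδ.le, hS.zero]; rfl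
    have h4 : Ψ 0 = 0 := intervalIntegral.integral_same
    rw [h3] at h2
    refine h2.congr fun t => ?_
    rw [h4, zero_add, sub_zero]
  -- The average is taken in `D(𝒬)`. The bounded inclusion into `H` commutes with the integral,
  -- which identifies it with the average of the orbit of `T`.
  have hgraph : ∀ t, 0 ≤ t → t ≤ δ → (toH (Ψ t), T t (toH v) - toH v) ∈ e.L.graph :=
    fun t ht ht' => by
    have h1 : toH (Ψ t) = ∫ s in (0 : ℝ)..t, T s (toH v) := by
      rw [← toHL_apply, ← ContinuousLinearMap.intervalIntegral_comp_comm _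
        (hψ.intervalIntegrable _ _)]
      refine intervalIntegral.integral_congr fun s hs => ?_
      rw [Set.uIcc_of_le ht] at hs
      simp only [toHL_apply]
      rw [hψS s hs.1 (hs.2.trans ht'), hST s hs.1]
    rw [h1]
    exact hT.integral_mem_graph hc hL _ ht
  have hex : ∀ t, 0 < t → t ≤ δ → ∃ u : e.preLambda.domain, (u : e.V) = t⁻¹ • Ψ t ∧
      e.preLambda u v ≤ 0 := fun t ht ht' => by
    obtain ⟨y, hy1, hy2⟩ := (LinearPMap.mem_graph_iff _).1
      (Submodule.smul_mem _ t⁻¹ (hgraph t ht.le ht'))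
    have hmem : toH (t⁻¹ • Ψ t) ∈ e.L.domain := by
      rw [map_smul]
      have := y.2
      rwa [hy1] at this
    refine ⟨⟨t⁻¹ • Ψ t, hmem⟩, rfl, ?_⟩
    have h2 : (⟨toH (t⁻¹ • Ψ t), hmem⟩ : e.L.domain) = y := Subtype.ext ((map_smul toH _ _).trans hy1.symm)
    rw [preLambda_apply]
    simp only
    rw [h2, hy2]
    simp only [Prod.smul_mk]
    rw [real_inner_smul_left]
    exact mul_nonpos_of_nonneg_of_nonpos (by positivity)
      (IsGeneratorOf.inner_le_zero.inner_sub_self_le_zero (hc t ht.le) _)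
  have hpos : ∀ n : ℕ, 0 < δ / ((n : ℝ) + 1) := fun n => by positivity
  have hle : ∀ n : ℕ, δ / ((n : ℝ) + 1) ≤ δ := fun n =>
    div_le_self hδ.le (by linarith [n.cast_nonneg (α := ℝ)])
  choose u hu1 hu2 using fun n : ℕ => hex _ (hpos n) (hle n)
  refine ⟨u, ?_, hu2⟩
  simp only [hu1]
  have hlim : Tendsto (fun n : ℕ => δ / ((n : ℝ) + 1)) atTop (𝓝[>] 0) := by
    refine tendsto_nhdsWithin_iff.2 ⟨?_, Eventually.of_forall hpos⟩
    simpa [div_eq_mul_inv] using tendsto_one_div_add_atTop_nhds_zero_nat.const_mul δ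
  exact hΨ.comp hlim

theorem dense_preLambda (he : e.IsAdmissible) : Dense (e.preLambda.domain : Set e.V) :=
  fun v => by
  obtain ⟨u, hu, -⟩ := he.exists_tendsto_preLambda v
  exact mem_closure_of_tendsto hu (Eventually.of_forall fun n => (u n).2)

theorem isClosable (he : e.IsAdmissible) : e.preLambda.IsClosable :=
  LinearPMap.isClosable_of_dissipative he.preLambda_self_nonpos he.dense_preLambda

theorem Lambda_self_nonpos (he : e.IsAdmissible) (u : e.F) : e.Lambda u (u : e.V) ≤ 0 := by
  refine apply_self_nonpos_of_mem_closure he.preLambda_self_nonpos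
    (p := ((u : e.V), e.Lambda u)) ?_
  rw [he.isClosable.graph_closure_eq_closure_graph]
  exact e.Lambda.mem_graph u

theorem norm_sq_le_form (he : e.IsAdmissible) (α : ℝ) (u : e.F) :
    min 1 α * ‖(u : e.V)‖ ^ 2 ≤ e.form α u (u : e.V) := by
  have h1 := he.Lambda_self_nonpos u
  have h2 := min_mul_norm_sq_le_shift α (u : e.V)
  rw [form]
  linarith

theorem denseRange_F_toH (he : e.IsAdmissible) : DenseRange (F.toH : e.F → H) := by
  have h1 : DenseRange (Subtype.val : e.F → e.V) := by
    rw [DenseRange, Subtype.range_val]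
    exact he.dense_preLambda.mono e.preLambda.le_closure.1
  exact (denseRange_toH he.coerciveClosed).comp h1 (toHL e.Q).continuous

theorem exists_form_eq (he : e.IsAdmissible) {α : ℝ} (hα : 0 < α) (l : StrongDual ℝ e.V) :
    ∃ u : e.F, ∀ v, e.form α u v = l v := by
  obtain ⟨K, hK⟩ := he.coerciveClosed.sector
  have := he.coerciveClosed.complete
  have hc : 0 < min 1 α := lt_min one_pos hα
  have hsep : ∀ v : e.V, (∀ u : e.F, (shiftL hK α u - e.Lambda u) v = 0) → v = 0 := by
    intro v hv
    obtain ⟨w, hw, hw'⟩ := he.exists_tendsto_preLambda v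
    -- If `v` is annihilated by the range, then `𝒬_α(w n, v) = ⟨Λ(w n), v⟩ ≤ 0` for the averages `w
    -- n → v`. In the limit `𝒬_α(v, v) ≤ 0`, so `v = 0` by coercivity.
    have h1 : ∀ n, shiftL hK α (w n) v ≤ 0 := fun n => by
      have h2 := hv ⟨w n, e.preLambda.le_closure.1 (w n).2⟩
      have h3 : e.Lambda ⟨w n, e.preLambda.le_closure.1 (w n).2⟩ = e.preLambda (w n) :=
        (e.preLambda.le_closure.2 rfl).symm
      rw [sub_apply, h3] at h2
      have := hw' n
      simp only at h2
      linarith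
    have h2 : Tendsto (fun n => shiftL hK α (w n) v) atTop (𝓝 (shiftL hK α v v)) := by
      have : Continuous fun x => shiftL hK α x v := by fun_prop
      exact (this.tendsto v).comp hw
    have h3 := le_of_tendsto' h2 h1
    have h4 := min_mul_norm_sq_le_shift α v
    rw [shiftL_apply] at h3
    have h5 : ‖v‖ ^ 2 ≤ 0 := by
      by_contra! h
      nlinarith [mul_pos hc h]
    simpa using le_antisymm h5 (by positivity)
  obtain ⟨u, hu⟩ := exists_sub_eq_of_dissipative he.Lambda_self_nonpos
    he.isClosable.closure_isClosed (shiftL hK α) hc (min_mul_norm_sq_le_shift α) hsep l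
  exact ⟨u, fun v => by rw [← hu]; rfl⟩

theorem F_ext (he : e.IsAdmissible) {α : ℝ} (hα : 0 < α) {u u' : e.F}
    (h : ∀ v, e.form α u v = e.form α u' v) : u = u' := by
  have h1 := he.norm_sq_le_form α (u - u')
  rw [form_sub_left, h, sub_self] at h1
  have hc : 0 < min 1 α := lt_min one_pos hα
  have h5 : ‖((u - u' : e.F) : e.V)‖ ^ 2 ≤ 0 := by
    by_contra! h
    nlinarith [mul_pos hc h]
  have h6 : ((u - u' : e.F) : e.V) = 0 := by simpa using le_antisymm h5 (by positivity)
  exact sub_eq_zero.1 (Subtype.ext h6)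

/-- For `α > 0` the default value `0` in the definition of `resolvent` is never taken because no
solution exists. -/
theorem resolvent_spec (he : e.IsAdmissible) {α : ℝ} (hα : 0 < α) (f : H) :
    ∃ u : e.F, F.toH u = e.resolvent α f ∧ ∀ v, e.form α u v = inner ℝ f (toH v) := by
  have h : ∃ u : e.F, ∀ v : e.V, e.form α u v = inner ℝ f (toH v) :=
    he.exists_form_eq hα (functional f)
  exact ⟨h.choose, by rw [resolvent, dif_pos h], h.choose_spec⟩

theorem resolvent_eq (he : e.IsAdmissible) {α : ℝ} (hα : 0 < α) {f : H} {u : e.F}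
    (hu : ∀ v, e.form α u v = inner ℝ f (toH v)) : e.resolvent α f = F.toH u := by
  obtain ⟨u', h1, h2⟩ := he.resolvent_spec hα f
  rw [← h1, he.F_ext hα fun v => (h2 v).trans (hu v).symm]

theorem resolvent_add (he : e.IsAdmissible) {α : ℝ} (hα : 0 < α) (f g : H) :
    e.resolvent α (f + g) = e.resolvent α f + e.resolvent α g := by
  obtain ⟨u, hu, hu'⟩ := he.resolvent_spec hα f
  obtain ⟨v, hv, hv'⟩ := he.resolvent_spec hα g
  rw [← hu, ← hv, ← F.toH_add]
  refine he.resolvent_eq hα fun w => ?_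
  rw [form_add_left, hu', hv', inner_add_left]

theorem resolvent_smul (he : e.IsAdmissible) {α : ℝ} (hα : 0 < α) (r : ℝ) (f : H) :
    e.resolvent α (r • f) = r • e.resolvent α f := by
  obtain ⟨u, hu, hu'⟩ := he.resolvent_spec hα f
  rw [← hu, ← F.toH_smul]
  refine he.resolvent_eq hα fun w => ?_
  rw [form_smul_left, hu', real_inner_smul_left]

theorem norm_resolvent_le (he : e.IsAdmissible) {α : ℝ} (hα : 0 < α) (f : H) :
    ‖e.resolvent α f‖ ≤ α⁻¹ * ‖f‖ := by
  obtain ⟨u, hu, hu'⟩ := he.resolvent_spec hα f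
  have h1 := hu' u
  have h2 : 0 ≤ e.Q.form (u : e.V) (u : e.V) := e.Q.nonneg _
  have h3 := he.Lambda_self_nonpos u
  have h4 : toH (u : e.V) = e.resolvent α f := hu
  rw [form, shift, h4, real_inner_self_eq_norm_sq] at h1
  have h5 := real_inner_le_norm f (e.resolvent α f)
  rw [le_inv_mul_iff₀ hα]
  rcases (norm_nonneg (e.resolvent α f)).eq_or_lt with h0 | h0
  · rw [← h0, mul_zero]
    exact norm_nonneg _
  · refine le_of_mul_le_mul_right ?_ h0
    nlinarith

/-- The resolvent as a bounded operator on `H`. -/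
noncomputable def resolventL (he : e.IsAdmissible) {α : ℝ} (hα : 0 < α) : H →L[ℝ] H :=
  LinearMap.mkContinuous
    { toFun := e.resolvent α
      map_add' := he.resolvent_add hα
      map_smul' := he.resolvent_smul hα } α⁻¹ (he.norm_resolvent_le hα)

/-- The resolvent equation. -/
theorem resolvent_resolvent (he : e.IsAdmissible) {α β : ℝ} (hα : 0 < α) (hβ : 0 < β) (f : H) :
    e.resolvent α f = e.resolvent β (f + (β - α) • e.resolvent α f) := by
  obtain ⟨u, hu, hu'⟩ := he.resolvent_spec hα f
  rw [← hu]
  refine (he.resolvent_eq hβ fun v => ?_).symm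
  rw [form_eq_form_add β α, hu', inner_add_left, real_inner_smul_left]

/-- With `x = α G_α u - u` one has `ℰ₁(x, x) + (α - 1) ‖x‖² = -ℰ(u, x) ≤ c ‖x‖_{D(𝒬)}`, where `c` is
the norm of the functional `ℰ(u, ·)`. Coercivity of `ℰ₁` absorbs the right side. -/
theorem exists_norm_smul_resolvent_sub_le (he : e.IsAdmissible) (u : e.F) :
    ∃ c : ℝ, ∀ α : ℝ, 1 < α →
      (α - 1) * ‖α • e.resolvent α (F.toH u) - F.toH u‖ ^ 2 ≤ c ^ 2 := by
  obtain ⟨K, hK⟩ := he.coerciveClosed.sector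
  refine ⟨‖shiftL hK 0 (u : e.V) - e.Lambda u‖, fun α hα => ?_⟩
  have hα0 : 0 < α := by linarith
  obtain ⟨g, hg, hg'⟩ := he.resolvent_spec hα0 (F.toH u)
  have hx : F.toH (α • g - u) = α • e.resolvent α (F.toH u) - F.toH u := by rw [← hg]; rfl
  rw [← hx]
  generalize hxx : α • g - u = x
  have h0 : α • g = x + u := by rw [← hxx, sub_add_cancel]
  have h1 : e.form 1 x x + (α - 1) * ‖F.toH x‖ ^ 2 = -e.form 0 u x := by
    have h2 : e.form α (α • g) (x : e.V) = α * inner ℝ (F.toH u) (F.toH x) := by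
      rw [form_smul_left, hg']
      rfl
    rw [h0, form_add_left, form_eq_form_add α 1 x, form_eq_form_add α 0 u] at h2
    have h3 : inner ℝ (F.toH x) (toH (x : e.V)) = ‖F.toH x‖ ^ 2 :=
      real_inner_self_eq_norm_sq _
    rw [h3] at h2
    have h4 : inner ℝ (F.toH u) (toH (x : e.V)) = inner ℝ (F.toH u) (F.toH x) := rfl
    rw [h4] at h2
    linarith
  have h2 := he.norm_sq_le_form 1 x
  have h3 : -e.form 0 u x ≤ ‖shiftL hK 0 (u : e.V) - e.Lambda u‖ * ‖(x : e.V)‖ :=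
    (neg_le_abs _).trans ((shiftL hK 0 (u : e.V) - e.Lambda u).le_opNorm (x : e.V))
  rw [min_self, one_mul] at h2
  nlinarith [sq_nonneg (‖shiftL hK 0 (u : e.V) - e.Lambda u‖ - ‖(x : e.V)‖),
    sq_nonneg (‖shiftL hK 0 (u : e.V) - e.Lambda u‖), sq_nonneg ‖(x : e.V)‖]

theorem norm_smul_resolvent_le (he : e.IsAdmissible) {α : ℝ} (hα : 0 < α) (f : H) :
    ‖α • e.resolvent α f‖ ≤ ‖f‖ := by
  rw [norm_smul, Real.norm_of_nonneg hα.le]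
  calc α * ‖e.resolvent α f‖ ≤ α * (α⁻¹ * ‖f‖) := by
        gcongr
        exact he.norm_resolvent_le hα f
    _ = ‖f‖ := by field_simp

/-- The resolvent is strongly continuous. -/
theorem tendsto_smul_resolvent (he : e.IsAdmissible) (f : H) :
    Tendsto (fun α : ℝ => α • e.resolvent α f) atTop (𝓝 f) := by
  rw [Metric.tendsto_atTop]
  intro ε hε
  obtain ⟨u, hu⟩ := he.denseRange_F_toH.exists_dist_lt f (show 0 < ε / 3 by positivity)
  obtain ⟨c, hc⟩ := he.exists_norm_smul_resolvent_sub_le u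
  refine ⟨2 + c ^ 2 / (ε / 3) ^ 2, fun α hα => ?_⟩
  have h0 : 0 ≤ c ^ 2 / (ε / 3) ^ 2 := by positivity
  have hα0 : 0 < α := by linarith
  have h1 := hc α (by linarith)
  have h2 : ‖α • e.resolvent α (F.toH u) - F.toH u‖ < ε / 3 := by
    refine lt_of_pow_lt_pow_left₀ 2 (by positivity) ?_
    have h3 : c ^ 2 < (α - 1) * (ε / 3) ^ 2 := by
      rw [← div_lt_iff₀ (by positivity)]
      linarith
    exact lt_of_mul_lt_mul_left (h1.trans_lt h3) (by linarith)
  have h3 : ‖α • e.resolvent α (f - F.toH u)‖ ≤ ‖f - F.toH u‖ := he.norm_smul_resolvent_le hα0 _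
  have h4 : α • e.resolvent α f - f = α • e.resolvent α (f - F.toH u) +
      (α • e.resolvent α (F.toH u) - F.toH u) - (f - F.toH u) := by
    have : e.resolvent α (f - F.toH u) = e.resolvent α f - e.resolvent α (F.toH u) :=
      map_sub (he.resolventL hα0) _ _
    rw [this, smul_sub]
    abel
  rw [dist_eq_norm] at hu ⊢
  rw [h4]
  have h5 := norm_sub_le (α • e.resolvent α (f - F.toH u) +
      (α • e.resolvent α (F.toH u) - F.toH u)) (f - F.toH u)
  have h6 := norm_add_le (α • e.resolvent α (f - F.toH u))
      (α • e.resolvent α (F.toH u) - F.toH u)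
  linarith

end IsAdmissible

end FormPair

end Resolvent

/-! ### The energy estimate -/

section Comparison

open FormDomain

variable {H : Type*} [NormedAddCommGroup H] [InnerProductSpace ℝ H] [CompleteSpace H]

namespace FormPair

variable {e : FormPair H}

namespace IsAdmissible

/-- The Cauchy-Schwarz inequality for the symmetric part of `-Λ`. -/
theorem Lambda_cauchy_schwarz (he : e.IsAdmissible) (u v : e.F) :
    (e.Lambda u (v : e.V) + e.Lambda v (u : e.V)) ^ 2 ≤
      4 * (e.Lambda u (u : e.V) * e.Lambda v (v : e.V)) := by
  have h : ∀ r : ℝ, 0 ≤ -e.Lambda v (v : e.V) * (r * r) +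
      -(e.Lambda u (v : e.V) + e.Lambda v (u : e.V)) * r + -e.Lambda u (u : e.V) := fun r => by
    have h1 := he.Lambda_self_nonpos (u + r • v)
    simp only [LinearPMap.map_add, LinearPMap.map_smul, Submodule.coe_add, Submodule.coe_smul,
      add_apply, smul_apply, map_add, map_smul, smul_eq_mul] at h1
    linarith
  have := discrim_le_zero h
  rw [discrim] at this
  linarith

/-- Write `p = ‖v‖`, `a = ‖f‖` in `D(𝒬)`, `b = ‖Λf‖`, `r² = -⟨Λv, v⟩` and `s² = ab ≥ -⟨Λf, f⟩`. The
hypothesis becomes `p² + r² ≤ (Ka + b) p + 2rs`. Young's inequality yields `(Ka + b)² + 4ab`, which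
is at most `(K + 1)² (a² + b²)` when `K ≥ 1`. -/
theorem form_self_le (he : e.IsAdmissible) {K : ℝ} (hK : e.Q.IsSectorConst K) {v f : e.F}
    (h : e.form 1 v (v : e.V) ≤ e.form 1 v (f : e.V)) :
    e.form 1 v (v : e.V) ≤ ((K + 1) * F.fnorm f) ^ 2 := by
  have hcs := he.Lambda_cauchy_schwarz v f
  have hσ := he.Lambda_self_nonpos v
  have hτ := he.Lambda_self_nonpos f
  have hτ' : -e.Lambda f (f : e.V) ≤ ‖e.Lambda f‖ * ‖(f : e.V)‖ :=
    (neg_le_abs _).trans ((e.Lambda f).le_opNorm _)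
  have h1 : e.Lambda f (v : e.V) ≤ ‖e.Lambda f‖ * ‖(v : e.V)‖ :=
    (le_abs_self _).trans ((e.Lambda f).le_opNorm _)
  have h2 := (le_abs_self _).trans (hK.2 (v : e.V) (f : e.V))
  have hf0 : ‖(f : e.V)‖ = 0 → ‖e.Lambda f‖ = 0 := fun h0 => by
    have : f = 0 := Subtype.ext (norm_eq_zero.1 h0)
    rw [this, LinearPMap.map_zero]
    exact norm_zero (E := StrongDual ℝ e.V)
  have hK1 : ‖(f : e.V)‖ ≠ 0 → 1 ≤ K := fun h0 => one_le_sectorConst hK (norm_ne_zero_iff.1 h0)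
  have hK0 := hK.1
  simp only [form, ← norm_sq] at h ⊢
  rw [F.fnorm, mul_pow, Real.sq_sqrt (by positivity)]
  have hp := norm_nonneg (v : e.V)
  have ha := norm_nonneg (f : e.V)
  have hb := norm_nonneg (e.Lambda f)
  generalize ‖(v : e.V)‖ = p at *
  generalize ‖(f : e.V)‖ = a at *
  generalize ‖e.Lambda f‖ = b at *
  generalize e.Lambda v (v : e.V) = σ at *
  generalize e.Lambda f (f : e.V) = τ at *
  generalize hx : e.Lambda v (f : e.V) = x at *
  generalize e.Lambda f (v : e.V) = y at *
  obtain ⟨r, hr, rfl⟩ : ∃ r, 0 ≤ r ∧ σ = -r ^ 2 :=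
    ⟨√(-σ), Real.sqrt_nonneg _, by rw [Real.sq_sqrt (by linarith), neg_neg]⟩
  obtain ⟨s, hs, hs2⟩ : ∃ s, 0 ≤ s ∧ s ^ 2 = b * a :=
    ⟨√(b * a), Real.sqrt_nonneg _, Real.sq_sqrt (by positivity)⟩
  have h3 : -(x + y) ≤ 2 * r * s := by
    refine (neg_le_abs _).trans (abs_le_of_sq_le_sq ?_ (by positivity))
    nlinarith [sq_nonneg r]
  have h4 : p ^ 2 + r ^ 2 ≤ (K * a + b) ^ 2 + 4 * s ^ 2 := by
    nlinarith [sq_nonneg (K * a + b - p), sq_nonneg (2 * s - r)]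
  -- A sector constant is at least `1` only if `D(𝒬)` is nontrivial, so `f = 0` is treated apart.
  by_cases h0 : a = 0
  · have hb0 := hf0 h0
    subst h0 hb0
    nlinarith
  · have := hK1 h0
    -- This expression equals `(K + 1)² (a² + b²) - (Ka + b)² - 4ab`.
    have h5 : 0 ≤ (K - 1) * a ^ 2 + (K - 1) * (K + 2) * b ^ 2 + (K + 2) * (a - b) ^ 2 := by
      have : 0 ≤ K - 1 := by linarith
      positivity
    nlinarith

end IsAdmissible

end FormPair

end Comparison

/-! ### Positivity, 1-excessive elements and reduced functions -/

section Excessive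

open FormDomain

variable {E : Type*} [MeasurableSpace E] {μ : Measure E}

theorem Lp.smul_le_smul_of_nonneg {f g : Lp ℝ 2 μ} (h : f ≤ g) {r : ℝ} (hr : 0 ≤ r) :
    r • f ≤ r • g := by
  rw [← Lp.coeFn_le] at h ⊢
  filter_upwards [h, Lp.coeFn_smul r f, Lp.coeFn_smul r g] with x hx h1 h2
  rw [h1, h2]
  exact mul_le_mul_of_nonneg_left hx hr

theorem L2.inner_nonneg {f g : Lp ℝ 2 μ} (hf : 0 ≤ f) (hg : 0 ≤ g) : 0 ≤ inner ℝ f g := by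
  rw [L2.inner_def]
  refine integral_nonneg_of_ae ?_
  filter_upwards [(Lp.coeFn_nonneg f).2 hf, (Lp.coeFn_nonneg g).2 hg] with x h1 h2
  exact mul_nonneg h2 h1

namespace FormPair

variable {e : FormPair (Lp ℝ 2 μ)}

namespace IsGeneralizedDirichletForm

/-- The resolvent of a generalized Dirichlet form is positivity preserving. -/
theorem resolvent_nonneg (he : e.IsGeneralizedDirichletForm) {α : ℝ} (hα : 0 < α)
    {f : Lp ℝ 2 μ} (hf : 0 ≤ f) : 0 ≤ e.resolvent α f := by
  obtain ⟨u, hu, hu'⟩ := he.admissible.resolvent_spec hα f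
  rw [← hu]
  generalize hU : F.toH u = U
  have hform : ∀ v : e.V, e.form 0 u v = inner ℝ (f - α • U) (toH v) := fun v => by
    rw [form_eq_form_add 0 α, hu', hU, inner_sub_left, real_inner_smul_left]
    ring
  let G : ℕ → E → ℝ := fun n x => (f - α • U) x * (U x - min (max (U x) 0) ((n : ℝ) + 1))
  have hG : ∀ n, 0 ≤ ∫ x, G n x ∂μ := fun n => by
    have hn : (0 : ℝ) < (n : ℝ) + 1 := by positivity
    -- Scaling turns truncation at `1` into truncation at `n + 1`. As `n → ∞` the test function `u -
    -- u⁺ ∧ (n + 1)` becomes `u - u⁺`.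
    obtain ⟨w, hw, hw'⟩ := he.unit_contraction (((n : ℝ) + 1)⁻¹ • u)
    have h1 : (((n : ℝ) + 1)⁻¹ • u : e.F) - w =
        ((n : ℝ) + 1)⁻¹ • ((u : e.V) - ((n : ℝ) + 1) • w) := by
      rw [smul_sub, smul_smul, inv_mul_cancel₀ hn.ne', one_smul]
      rfl
    rw [form_smul_left, h1, form_smul_right, hform, map_sub, map_smul] at hw'
    have h2 : 0 ≤ inner ℝ (f - α • U) (U - ((n : ℝ) + 1) • toH w) := by
      have h3 : 0 < ((n : ℝ) + 1)⁻¹ := by positivity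
      have h4 := nonneg_of_mul_nonneg_right (nonneg_of_mul_nonneg_right hw' h3) h3
      rw [← hU] at h4 ⊢
      exact h4
    rw [L2.inner_def] at h2
    refine h2.trans_eq (integral_congr_ae ?_)
    rw [F.toH_smul, hU] at hw
    filter_upwards [hw, Lp.coeFn_smul ((n : ℝ) + 1)⁻¹ U, Lp.coeFn_smul ((n : ℝ) + 1) (toH w),
      Lp.coeFn_sub U (((n : ℝ) + 1) • toH w)] with x h3 h4 h5 h6
    have h7 : ((n : ℝ) + 1) * min (max (((n : ℝ) + 1)⁻¹ * U x) 0) 1 =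
        min (max (U x) 0) ((n : ℝ) + 1) := by
      rw [mul_min_of_nonneg _ _ hn.le, mul_max_of_nonneg _ _ hn.le, mul_one, mul_zero,
        mul_inv_cancel_left₀ hn.ne']
    simp only [G]
    rw [h6, Pi.sub_apply, h5, Pi.smul_apply, h3, h4, Pi.smul_apply, smul_eq_mul, smul_eq_mul, h7]
    exact mul_comm _ _
  have hint : Integrable (fun x => (f - α • U) x * U x) μ := by
    have := L2.integrable_inner (𝕜 := ℝ) U (f - α • U)
    exact this
  have hlim : Tendsto (fun n => ∫ x, G n x ∂μ) atTop
      (𝓝 (∫ x, (f - α • U) x * (U x - max (U x) 0) ∂μ)) := by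
    refine tendsto_integral_of_dominated_convergence (fun x => ‖(f - α • U) x * U x‖) ?_
      hint.norm ?_ ?_
    · intro n
      have h1 := Lp.aestronglyMeasurable (f - α • U)
      have h2 := Lp.aestronglyMeasurable U
      exact h1.mul (h2.sub ((h2.sup aestronglyMeasurable_const).inf aestronglyMeasurable_const))
    · intro n
      refine Eventually.of_forall fun x => ?_
      simp only [G, norm_mul]
      refine mul_le_mul_of_nonneg_left ?_ (norm_nonneg _)
      have hn : (0 : ℝ) < (n : ℝ) + 1 := by positivity
      rw [Real.norm_eq_abs, Real.norm_eq_abs]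
      rcases le_total (U x) 0 with h | h
      · rw [max_eq_right h, min_eq_left hn.le, sub_zero]
      · rw [max_eq_left h, abs_of_nonneg h, abs_of_nonneg (sub_nonneg.2 (min_le_left _ _))]
        linarith [le_min h hn.le]
    · refine Eventually.of_forall fun x => ?_
      refine tendsto_const_nhds.congr' ?_
      obtain ⟨N, hN⟩ := exists_nat_ge (max (U x) 0)
      filter_upwards [eventually_ge_atTop N] with n hn
      have : (N : ℝ) ≤ n := by exact_mod_cast hn
      simp only [G]
      rw [min_eq_left (by linarith)]
  have h0 : 0 ≤ ∫ x, (f - α • U) x * (U x - max (U x) 0) ∂μ := ge_of_tendsto' hlim hG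
  have hcoe : ∀ᵐ x ∂μ, (f - α • U) x = f x - α * U x := by
    filter_upwards [Lp.coeFn_sub f (α • U), Lp.coeFn_smul α U] with x h1 h2
    rw [h1, Pi.sub_apply, h2, Pi.smul_apply, smul_eq_mul]
  -- Where `U < 0`, both `f` and `-αU` are nonnegative while `U - U⁺ = U`. The integrand of `h0` is
  -- thus nonpositive with nonnegative integral, which forces `U⁻ = 0`.
  have hpt : ∀ᵐ x ∂μ, α * (U x - max (U x) 0) ^ 2 ≤
      -((f - α • U) x * (U x - max (U x) 0)) := by
    filter_upwards [hcoe, (Lp.coeFn_nonneg f).2 hf] with x h1 h2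
    have h2 : 0 ≤ f x := h2
    rw [h1]
    rcases le_total (U x) 0 with h | h
    · rw [max_eq_right h, sub_zero]
      nlinarith
    · rw [max_eq_left h]
      simp
  have hnn : 0 ≤ᵐ[μ] fun x => -((f - α • U) x * (U x - max (U x) 0)) := by
    filter_upwards [hpt] with x hx
    exact le_trans (by positivity) hx
  have hint' : Integrable (fun x => -((f - α • U) x * (U x - max (U x) 0))) μ := by
    refine (hint.mono ?_ (Eventually.of_forall fun x => ?_)).neg
    · have h1 := Lp.aestronglyMeasurable (f - α • U)
      have h2 := Lp.aestronglyMeasurable U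
      exact h1.mul (h2.sub (h2.sup aestronglyMeasurable_const))
    · rw [norm_mul, norm_mul]
      refine mul_le_mul_of_nonneg_left ?_ (norm_nonneg _)
      rcases le_total (U x) 0 with h | h
      · rw [max_eq_right h, sub_zero]
      · rw [max_eq_left h, sub_self, norm_zero]
        exact norm_nonneg _
  have hzero : ∫ x, -((f - α • U) x * (U x - max (U x) 0)) ∂μ = 0 := by
    refine le_antisymm ?_ (integral_nonneg_of_ae hnn)
    rw [integral_neg]
    linarith
  rw [← Lp.coeFn_nonneg]
  filter_upwards [hpt, (integral_eq_zero_iff_of_nonneg_ae hnn hint').1 hzero] with x h1 h2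
  rw [h2, Pi.zero_apply] at h1
  have h3 : (U x - max (U x) 0) ^ 2 ≤ 0 := by
    by_contra! h
    nlinarith [mul_pos hα h]
  have h4 : U x - max (U x) 0 = 0 := by simpa using le_antisymm h3 (by positivity)
  have h5 := le_max_right (U x) 0
  change 0 ≤ U x
  linarith

theorem resolvent_mono (he : e.IsGeneralizedDirichletForm) {α : ℝ} (hα : 0 < α)
    {f g : Lp ℝ 2 μ} (h : f ≤ g) : e.resolvent α f ≤ e.resolvent α g := by
  have h1 := he.resolvent_nonneg hα (sub_nonneg.2 h)
  have h2 : e.resolvent α (g - f) = e.resolvent α g - e.resolvent α f :=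
    map_sub (he.admissible.resolventL hα) g f
  rwa [h2, sub_nonneg] at h1

theorem smul_resolvent_mono (he : e.IsGeneralizedDirichletForm) {α : ℝ} (hα : 0 ≤ α)
    {f g : Lp ℝ 2 μ} (h : f ≤ g) : α • e.resolvent (α + 1) f ≤ α • e.resolvent (α + 1) g :=
  Lp.smul_le_smul_of_nonneg (he.resolvent_mono (by linarith) h) hα

/-- From `G₂ u ≤ u` and positivity, `u⁻ ≤ G₂ u⁻`. Since `‖G₂‖ ≤ 1/2`, `u⁻ = 0`. -/
theorem nonneg_of_isOneExcessive (he : e.IsGeneralizedDirichletForm) {u : Lp ℝ 2 μ}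
    (hu : e.IsOneExcessive u) : 0 ≤ u := by
  have h2 : (0 : ℝ) < 1 + 1 := by norm_num
  have h1 := hu 1 zero_le_one
  rw [one_smul] at h1
  have h3 : -u ⊔ 0 ≤ e.resolvent (1 + 1) (-u ⊔ 0) := by
    refine sup_le ?_ (he.resolvent_nonneg h2 le_sup_right)
    have h4 : e.resolvent (1 + 1) (-u) = -e.resolvent (1 + 1) u :=
      map_neg (he.admissible.resolventL h2) u
    exact ((neg_le_neg h1).trans_eq h4.symm).trans (he.resolvent_mono h2 le_sup_left)
  have h4 : ‖-u ⊔ 0‖ ≤ ‖e.resolvent (1 + 1) (-u ⊔ 0)‖ := by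
    refine norm_le_norm_of_abs_le_abs ?_
    rw [abs_of_nonneg (le_sup_right : 0 ≤ -u ⊔ 0)]
    exact h3.trans (le_abs_self _)
  have h5 := he.admissible.norm_resolvent_le h2 (-u ⊔ 0)
  have h6 : ‖-u ⊔ 0‖ ≤ 0 := by
    rw [show ((1 : ℝ) + 1)⁻¹ = 1 / 2 by norm_num] at h5
    have h7 : ‖-u ⊔ 0‖ ≤ 1 / 2 * ‖-u ⊔ 0‖ := h4.trans h5
    linarith
  have h7 : -u ≤ 0 := by
    have : -u ⊔ 0 = 0 := norm_le_zero_iff.1 h6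
    exact le_sup_left.trans_eq this
  exact neg_nonpos.1 h7

theorem isOneExcessive_inf (he : e.IsGeneralizedDirichletForm) {u v : Lp ℝ 2 μ}
    (hu : e.IsOneExcessive u) (hv : e.IsOneExcessive v) : e.IsOneExcessive (u ⊓ v) :=
  fun α hα => le_inf ((he.smul_resolvent_mono hα inf_le_left).trans (hu α hα))
    ((he.smul_resolvent_mono hα inf_le_right).trans (hv α hα))

theorem isClosed_isOneExcessive (he : e.IsGeneralizedDirichletForm) :
    IsClosed {u | e.IsOneExcessive u} := by
  simp only [IsOneExcessive, Set.ofPred_forall]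
  refine isClosed_iInter fun α => isClosed_iInter fun hα => ?_
  have h1 : (0 : ℝ) < α + 1 := by linarith
  exact isClosed_le ((he.admissible.resolventL h1).continuous.const_smul α) continuous_id

theorem convex_isOneExcessive (he : e.IsGeneralizedDirichletForm) :
    Convex ℝ {u | e.IsOneExcessive u} := by
  intro u hu v hv a b ha hb _ α hα
  have h1 : (0 : ℝ) < α + 1 := by linarith
  rw [he.admissible.resolvent_add h1, he.admissible.resolvent_smul h1,
    he.admissible.resolvent_smul h1, smul_add, smul_comm α a, smul_comm α b]
  exact add_le_add (Lp.smul_le_smul_of_nonneg (hu α hα) ha)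
    (Lp.smul_le_smul_of_nonneg (hv α hα) hb)

/-- `G₁ h` is 1-excessive for `h ≥ 0`. -/
theorem isOneExcessive_resolvent (he : e.IsGeneralizedDirichletForm) {h : Lp ℝ 2 μ}
    (hh : 0 ≤ h) : e.IsOneExcessive (e.resolvent 1 h) := fun α hα => by
  have h1 : (0 : ℝ) < α + 1 := by linarith
  have h2 := he.admissible.resolvent_resolvent one_pos h1 h
  rw [add_sub_cancel_right, he.admissible.resolvent_add h1, he.admissible.resolvent_smul h1] at h2
  conv_rhs => rw [h2]
  exact le_add_of_nonneg_left (he.resolvent_nonneg h1 hh)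

/-- The 1-reduced function is the dominating 1-excessive element of minimal norm. -/
theorem exists_isReduced (he : e.IsGeneralizedDirichletForm) {U : Set E} (hU : MeasurableSet U)
    {u : Lp ℝ 2 μ} (hu : e.IsOneExcessive u) : ∃ w, e.IsReduced U u w := by
  let g : Lp ℝ 2 μ := ((Lp.memLp u).indicator hU).toLp _
  have hg : ∀ v : Lp ℝ 2 μ, (∀ᵐ x ∂μ, U.indicator u x ≤ v x) ↔ g ≤ v := fun v => by
    rw [← Lp.coeFn_le]
    have h1 := ((Lp.memLp u).indicator hU).coeFn_toLp
    constructor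
    · intro h
      filter_upwards [h, h1] with x hx hx1
      rwa [hx1]
    · intro h
      filter_upwards [h, h1] with x hx hx1
      rwa [hx1] at hx
  have hgu : g ≤ u := by
    rw [← hg]
    filter_upwards [(Lp.coeFn_nonneg u).2 (he.nonneg_of_isOneExcessive hu)] with x hx
    exact Set.indicator_le_self' (fun _ _ => hx) x
  let M : Set (Lp ℝ 2 μ) := {v | e.IsOneExcessive v} ∩ Set.Ici g
  have hM : {v : Lp ℝ 2 μ | e.IsOneExcessive v ∧ ∀ᵐ x ∂μ, U.indicator u x ≤ v x} = M := by
    ext v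
    exact and_congr_right fun _ => hg v
  have hconv : Convex ℝ M := by
    refine he.convex_isOneExcessive.inter ?_
    intro v hv w hw a b ha hb hab
    have h1 : g = a • g + b • g := by rw [← add_smul, hab, one_smul]
    rw [Set.mem_Ici, h1]
    exact add_le_add (Lp.smul_le_smul_of_nonneg hv ha) (Lp.smul_le_smul_of_nonneg hw hb)
  have hcomp : IsComplete M := (he.isClosed_isOneExcessive.inter isClosed_Ici).isComplete
  obtain ⟨w, hw, hmin⟩ := exists_norm_eq_iInf_of_complete_convex (K := M) ⟨u, hu, hgu⟩ hcomp hconv 0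
  rw [norm_eq_iInf_iff_real_inner_le_zero hconv hw] at hmin
  refine ⟨w, ?_⟩
  rw [IsReduced, hM]
  refine ⟨hw, fun v hv => ?_⟩
  -- For any competitor `v`, the infimum `w ⊓ v` also competes and has norm at most `‖w‖`. The
  -- variational inequality for the minimiser then gives `w ⊓ v = w`.
  have h1 : w ⊓ v ∈ M := ⟨he.isOneExcessive_inf hw.1 hv.1, Set.mem_Ici.2 (le_inf hw.2 hv.2)⟩
  have h2 := hmin _ h1
  rw [zero_sub, inner_neg_left, inner_sub_right, real_inner_self_eq_norm_sq] at h2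
  have h3 : ‖w ⊓ v‖ ≤ ‖w‖ := by
    refine norm_le_norm_of_abs_le_abs ?_
    rw [abs_of_nonneg (he.nonneg_of_isOneExcessive h1.1),
      abs_of_nonneg (he.nonneg_of_isOneExcessive hw.1)]
    exact inf_le_left
  have h4 := norm_sub_sq_real w (w ⊓ v)
  have h5 : ‖w - w ⊓ v‖ ^ 2 ≤ 0 := by nlinarith [norm_nonneg (w ⊓ v), norm_nonneg w]
  have h6 : w - w ⊓ v = 0 := by simpa using le_antisymm h5 (by positivity)
  rw [sub_eq_zero.1 h6]
  exact inf_le_right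

theorem isReduced_reduced (he : e.IsGeneralizedDirichletForm) {U : Set E} (hU : MeasurableSet U)
    {u : Lp ℝ 2 μ} (hu : e.IsOneExcessive u) : e.IsReduced U u (e.reduced U u) := by
  have h := he.exists_isReduced hU hu
  rw [reduced, dif_pos h]
  exact h.choose_spec

theorem le_of_isReduced (he : e.IsGeneralizedDirichletForm) {U : Set E}
    {u w : Lp ℝ 2 μ} (hu : e.IsOneExcessive u) (hw : e.IsReduced U u w) : w ≤ u := by
  refine hw.2 ⟨hu, ?_⟩
  filter_upwards [(Lp.coeFn_nonneg u).2 (he.nonneg_of_isOneExcessive hu)] with x hx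
  exact Set.indicator_le_self' (fun _ _ => hx) x

theorem ae_eq_of_isReduced (he : e.IsGeneralizedDirichletForm) {U : Set E}
    {u w : Lp ℝ 2 μ} (hu : e.IsOneExcessive u) (hw : e.IsReduced U u w) :
    ∀ᵐ x ∂μ, x ∈ U → w x = u x := by
  filter_upwards [hw.1.2, (Lp.coeFn_le _ _).2 (he.le_of_isReduced hu hw)] with x h1 h2 hx
  rw [Set.indicator_of_mem hx] at h1
  exact le_antisymm h2 h1

/-- 1-excessive elements dominated by an element of `ℱ` are in `D(𝒜)`, with a bound on the
norm. -/
theorem exists_toH_eq_of_isOneExcessive (he : e.IsGeneralizedDirichletForm)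
    {A : NonnegForm (Lp ℝ 2 μ)} [CompleteSpace (FormDomain A)] {K C : ℝ}
    (hK : e.Q.IsSectorConst K) (hC : e.C1 A C) {u : Lp ℝ 2 μ} (hu : e.IsOneExcessive u) {f : e.F}
    (hf : u ≤ F.toH f) :
    ∃ w : FormDomain A, toH w = u ∧ ‖w‖ ≤ √C * (K + 1) * F.fnorm f := by
  have hex : ∀ n : ℕ, ∃ w : FormDomain A, toH w = (n : ℝ) • e.resolvent ((n : ℝ) + 1) u ∧
      ‖w‖ ≤ √C * (K + 1) * F.fnorm f := fun n => by
    have hn : (0 : ℝ) < (n : ℝ) + 1 := by positivity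
    obtain ⟨g, hg, hg'⟩ := he.admissible.resolvent_spec hn u
    have hle := hu n n.cast_nonneg
    rw [← hg, ← F.toH_smul] at hle ⊢
    generalize hv : (n : ℝ) • g = v at hle ⊢
    -- Lowering the shift from `n + 1` to `1` moves `n (v, x)` to the right side of the resolvent
    -- identity.
    have hform : ∀ x : e.V, e.form 1 v x = (n : ℝ) * inner ℝ (u - F.toH v) (toH x) := fun x => by
      have h1 : e.form ((n : ℝ) + 1) v x = n * inner ℝ u (toH x) := by
        rw [← hv, form_smul_left, hg']
      rw [form_eq_form_add 1 ((n : ℝ) + 1), h1, inner_sub_left]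
      ring
    have hcomp : e.form 1 v (v : e.V) ≤ e.form 1 v (f : e.V) := by
      rw [hform, hform]
      refine mul_le_mul_of_nonneg_left ?_ n.cast_nonneg
      rw [← sub_nonneg, ← inner_sub_right]
      exact L2.inner_nonneg (sub_nonneg.2 hle) (sub_nonneg.2 (hle.trans hf))
    obtain ⟨w, hw, hw'⟩ := hC.2 v
    refine ⟨w, hw, ?_⟩
    have h1 := he.admissible.form_self_le hK hcomp
    have h2 : 0 ≤ F.fnorm f := Real.sqrt_nonneg _
    have h3 := hK.1
    refine le_of_abs_le (abs_le_of_sq_le_sq ?_ (by positivity))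
    rw [norm_sq, mul_assoc, mul_pow, Real.sq_sqrt hC.1.le]
    exact hw'.trans (mul_le_mul_of_nonneg_left h1 hC.1.le)
  choose w hw hwn using hex
  refine exists_preimage_of_bounded_of_tendsto (l := atTop) (toHL A) (Eventually.of_forall hwn) ?_
  simp only [toHL_apply, hw]
  have h1 : Tendsto (fun n : ℕ => (n : ℝ) + 1) atTop atTop :=
    tendsto_natCast_atTop_atTop.atTop_add tendsto_const_nhds
  -- The factor `n / (n + 1)` converts `(n + 1) G_{n+1} u → u` into `n G_{n+1} u → u`.
  have h2 := (tendsto_natCast_div_add_atTop (1 : ℝ)).smul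
    ((he.admissible.tendsto_smul_resolvent u).comp h1)
  rw [one_smul] at h2
  refine h2.congr fun n => ?_
  have hn : (n : ℝ) + 1 ≠ 0 := by positivity
  simp only [Function.comp_apply]
  rw [smul_smul, div_mul_cancel₀ _ hn]

end IsGeneralizedDirichletForm

end FormPair

end Excessive

/-! ### Comparison of nests -/

section Nests

open FormDomain

variable {E : Type*} [MeasurableSpace E] {μ : Measure E}

/-- The elements of `D(𝒜)` that vanish outside one of the sets of an increasing sequence. -/
def NonnegForm.vanishing (A : NonnegForm (Lp ℝ 2 μ)) {S : ℕ → Set E} (hS : Monotone S) :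
    Submodule ℝ (FormDomain A) where
  carrier := {w | ∃ k, ∀ᵐ x ∂μ, x ∈ (S k)ᶜ → toH w x = 0}
  zero_mem' := by
    refine ⟨0, ?_⟩
    rw [map_zero]
    filter_upwards [Lp.coeFn_zero ℝ 2 μ] with x hx _
    simpa using hx
  add_mem' := by
    rintro u v ⟨j, hj⟩ ⟨k, hk⟩
    refine ⟨max j k, ?_⟩
    rw [map_add]
    filter_upwards [hj, hk, Lp.coeFn_add (toH u) (toH v)] with x h1 h2 h3 hx
    rw [h3, Pi.add_apply, h1 fun h => hx (hS (le_max_left j k) h),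
      h2 fun h => hx (hS (le_max_right j k) h), add_zero]
  smul_mem' := by
    rintro r u ⟨k, hk⟩
    refine ⟨k, ?_⟩
    rw [map_smul]
    filter_upwards [hk, Lp.coeFn_smul r (toH u)] with x h1 h2 hx
    rw [h2, Pi.smul_apply, h1 hx, smul_zero]

/-- A subspace of a Hilbert space contains in its closure the limits of weakly convergent
sequences of its elements. -/
theorem Submodule.mem_topologicalClosure_of_tendsto_weak {X : Type*} [NormedAddCommGroup X]
    [InnerProductSpace ℝ X] [CompleteSpace X] (N : Submodule ℝ X) {w : ℕ → X} {x : X}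
    (hN : ∀ k, x - w k ∈ N) (hw : ∀ l : StrongDual ℝ X, Tendsto (fun k => l (w k)) atTop (𝓝 0)) :
    x ∈ N.topologicalClosure := by
  rw [← Submodule.orthogonal_orthogonal_eq_closure, Submodule.mem_orthogonal]
  intro y hy
  have h1 : ∀ k, inner ℝ y x = innerSL ℝ y (w k) := fun k => by
    have := Submodule.inner_left_of_mem_orthogonal (hN k) hy
    rw [inner_sub_right, sub_eq_zero] at this
    exact this
  exact tendsto_nhds_unique (tendsto_const_nhds.congr h1) (hw (innerSL ℝ y))

namespace FormPair.IsGeneralizedDirichletForm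

variable {e : FormPair (Lp ℝ 2 μ)} [TopologicalSpace E] [BorelSpace E]

/-- The reduced functions of `u = G₁h` on the complements of the `S k` are all dominated by `u ∈ ℱ`
itself, so one bound in `D(𝒜)` serves for every `k`. Together with `L²` convergence to `0` it gives
weak convergence in `D(𝒜)`. -/
theorem mem_closure_vanishing (he : e.IsGeneralizedDirichletForm)
    {A : NonnegForm (Lp ℝ 2 μ)} [CompleteSpace (FormDomain A)] {K C : ℝ}
    (hK : e.Q.IsSectorConst K) (hC : e.C1 A C) {S : ℕ → Set E} (hS : e.IsNest S)
    {h : Lp ℝ 2 μ} (hh : 0 ≤ h) {z : FormDomain A} (hz : toH z = e.resolvent 1 h) :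
    z ∈ (A.vanishing hS.1).topologicalClosure := by
  obtain ⟨u, hu, -⟩ := he.admissible.resolvent_spec one_pos h
  have hexc : e.IsOneExcessive (F.toH u) := hu ▸ he.isOneExcessive_resolvent hh
  have hred : ∀ k, e.IsReduced (S k)ᶜ (F.toH u) (e.reduced (S k)ᶜ (F.toH u)) := fun k =>
    he.isReduced_reduced (hS.2.1 k).measurableSet.compl hexc
  choose w hw hwn using fun k => he.exists_toH_eq_of_isOneExcessive hK hC (hred k).1.1
    (he.le_of_isReduced hexc (hred k))
  have hlim : Tendsto (fun k => toHL A (w k)) atTop (𝓝 0) := by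
    simp only [toHL_apply, hw]
    exact (hS.2.2 u hexc).1
  refine Submodule.mem_topologicalClosure_of_tendsto_weak _ (w := w) (fun k => ?_)
    (tendsto_weak_zero_of_bounded (toHL A) toH_injective (Eventually.of_forall hwn) hlim)
  refine ⟨k, ?_⟩
  rw [map_sub, hw, hz, ← hu]
  filter_upwards [he.ae_eq_of_isReduced hexc (hred k),
    Lp.coeFn_sub (F.toH u) (e.reduced (S k)ᶜ (F.toH u))] with x h1 h2 hx
  rw [h2, Pi.sub_apply, h1 hx, sub_self]

/-- Nests of the generalized Dirichlet form are nests of `𝒜`. -/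
theorem isNest_of_isNest (he : e.IsGeneralizedDirichletForm)
    {A : NonnegForm (Lp ℝ 2 μ)} [CompleteSpace (FormDomain A)] {K C : ℝ}
    (hK : e.Q.IsSectorConst K) (hC : e.C1 A C) (hC2 : e.C2 A) {S : ℕ → Set E}
    (hS : e.IsNest S) : A.IsNest S := by
  refine ⟨hS.1, hS.2.1, ?_⟩
  obtain ⟨γ, hγ, -, hdense⟩ := hC2
  have hsub : {w : FormDomain A | ∃ f : Lp ℝ 2 μ, MemLp f ∞ μ ∧ toH w = e.resolvent γ f} ⊆
      ((A.vanishing hS.1).topologicalClosure : Set (FormDomain A)) := by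
    rintro z ⟨f, -, hz⟩
    -- `G_γ f` is rewritten as `G₁ h`, because `G₁` of the positive and negative parts of `h` is
    -- 1-excessive.
    rw [he.admissible.resolvent_resolvent hγ one_pos] at hz
    generalize f + (1 - γ) • e.resolvent γ f = h at hz
    have hin : ∀ g : Lp ℝ 2 μ, ∃ y : FormDomain A, toH y = e.resolvent 1 g := fun g => by
      obtain ⟨u, hu, -⟩ := he.admissible.resolvent_spec one_pos g
      obtain ⟨y, hy, -⟩ := hC.2 u
      exact ⟨y, hy.trans hu⟩
    obtain ⟨y₁, hy₁⟩ := hin h⁺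
    obtain ⟨y₂, hy₂⟩ := hin h⁻
    have hzy : z = y₁ - y₂ := toH_injective (by
      have h1 : e.resolvent 1 (h⁺ - h⁻) = e.resolvent 1 h⁺ - e.resolvent 1 h⁻ :=
        map_sub (he.admissible.resolventL one_pos) _ _
      rw [hz, map_sub, hy₁, hy₂, ← h1, posPart_sub_negPart])
    rw [hzy]
    exact Submodule.sub_mem _ (he.mem_closure_vanishing hK hC hS (posPart_nonneg h) hy₁)
      (he.mem_closure_vanishing hK hC hS (negPart_nonneg h) hy₂)
  have h1 := hdense.mono hsub
  rw [Submodule.topologicalClosure_coe] at h1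
  exact dense_closure.1 h1

end FormPair.IsGeneralizedDirichletForm

end Nests

theorem mainTheorem8 {E : Type*} [TopologicalSpace E] [MeasurableSpace E] [BorelSpace E]
    (μ : Measure E) [SigmaFinite μ]
    (A : NonnegForm (Lp ℝ 2 μ)) (hA : IsSemiDirichletForm A)
    (e : FormPair (Lp ℝ 2 μ)) (he : e.IsGeneralizedDirichletForm)
    (K' : ℝ) (hK' : e.Q.IsSectorConst K')
    (C : ℝ) (hC1 : e.C1 A C) (hC2 : e.C2 A) :
    -- (i)
    (∀ u : Lp ℝ 2 μ, e.IsOneExcessive u → (∃ f : e.F, u ≤ FormPair.F.toH f) → u ∈ A.domain) ∧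
    -- (ii)
    (∀ u : Lp ℝ 2 μ, e.IsOneExcessive u → ∀ f : e.F, u ≤ FormPair.F.toH f →
      ∀ U : Set E, IsOpen U →
        e.IsReduced U u (e.reduced U u) ∧
        ∃ w : FormDomain A, FormDomain.toH w = e.reduced U u ∧
          ‖w‖ ≤ (√C * (K' + 1) + 1) * FormPair.F.fnorm f) ∧
    -- (iii)
    (∀ S : ℕ → Set E, e.IsNest S → A.IsNest S) := by
  have := hA.coerciveClosed.complete
  refine ⟨fun u hu ⟨f, hf⟩ => ?_, fun u hu f hf U hU => ?_, fun S hS =>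
    he.isNest_of_isNest hK' hC1 hC2 hS⟩
  · obtain ⟨w, hw, -⟩ := he.exists_toH_eq_of_isOneExcessive hK' hC1 hu hf
    exact hw ▸ FormDomain.toH_mem w
  · have hred := he.isReduced_reduced hU.measurableSet hu
    -- The estimate is applied to `u_U`, which inherits the majorant `f` from `u`.
    obtain ⟨w, hw, hwn⟩ := he.exists_toH_eq_of_isOneExcessive hK' hC1 hred.1.1
      ((he.le_of_isReduced hu hred).trans hf)
    refine ⟨hred, w, hw, hwn.trans (mul_le_mul_of_nonneg_right (by linarith) ?_)⟩
    exact Real.sqrt_nonneg _
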